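/- Let $\Omega\subset\mathbb R^{d+1}$ be a bounded domain (nonempty connected open set) with Lipschitz boundary $\Sigma=\partial\Omega$; that is, near every point of $\Sigma$, in suitably rotated Cartesian coordinates $(x',x_{d+1})$, the set $\Omega$ coincides with the region $\{x_{d+1}>\psi(x')\}$ strictly above the graph of a Lipschitz function $\psi$. Let $\Gamma$ be a $C^\infty$ vector field on $\mathbb R^{d+1}$ that is transversal to $\Sigma$: there is a constant $\theta<\pi/2$ such that at every point $x\in\Sigma$ where the tangent plane to $\Sigma$ exists, $|\Gamma(x)|=1$ and the angle between $\Gamma(x)$ and the exterior unit normal to $\Sigma$ at $x$ is at most $\theta$. Then there are an interior collar neighborhood $U$ of $\Sigma$ and a compact smooth ($C^\infty$, embedded, without boundary) hypersurface $S\subset U$ such that 1. every maximal integral curve $\gamma:J\to U$ of $\Gamma$ in $U$ meets $S$ exactly once, i.e. $\gamma(t)\in S$ for exactly one $t\in J$; 2. these intersections are transversal: $\Gamma(p)\notin T_pS$ for every $p\in S$. Here an interior collar neighborhood of $\Sigma$ is an open set $U\subset\Omega$ such that every point of $\Sigma$ has a neighborhood $V$ with $V\cap\Omega\subset U$, and such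 that there is a homeomorphism $h:\Sigma\times[0,1)\to\Sigma\cup U$ with $h(x,0)=x$ for all $x\in\Sigma$. A maximal integral curve of $\Gamma$ in $U$ is a solution $\gamma:J\to U$ of $\gamma'=\Gamma(\gamma)$ on a nonempty open interval $J$ that cannot be extended to a solution with values in $U$ on a larger open interval. -/

import Mathlib

open Set Filter Topology
open scoped InnerProductSpace ContDiff

namespace LipschitzSurface

variable {E : Type*} [NormedAddCommGroup E] [InnerProductSpace ℝ E]

/-- `Ω` has (strongly) Lipschitz boundary: near every boundary point there are a unit vector `e`
(the direction of the last axis of a rotated Cartesian coordinate system, the other coordinates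
being those of the hyperplane orthogonal to `e`) and a Lipschitz function `ψ` on that hyperplane
such that `Ω` coincides near the point with the region strictly above the graph of `ψ`; the
boundary of `Ω` then coincides near the point with the graph itself. -/
def HasLipschitzBoundary (Ω : Set E) : Prop :=
  ∀ x ∈ frontier Ω, ∃ (e : E) (K : NNReal) (ψ : ((ℝ ∙ e)ᗮ : Submodule ℝ E) → ℝ) (V : Set E),
    ‖e‖ = 1 ∧ LipschitzWith K ψ ∧ IsOpen V ∧ x ∈ V ∧
      ∀ y ∈ V, (y ∈ Ω ↔ ψ ((ℝ ∙ e)ᗮ.orthogonalProjectionOnto y) < ⟪e, y⟫_ℝ)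

/-- A bounded Lipschitz domain: a nonempty bounded connected open set with Lipschitz boundary. -/
structure IsBoundedLipschitzDomain (Ω : Set E) : Prop where
  isOpen : IsOpen Ω
  isConnected : IsConnected Ω
  isBounded : Bornology.IsBounded Ω
  lipschitz : HasLipschitzBoundary Ω

/-- The boundary of `Ω` has a tangent plane at its point `x`, namely the hyperplane through `x`
orthogonal to the unit vector `ν`, and `ν` points out of `Ω`. Thus the tangent plane exists at `x`
if and only if some `ν` satisfies this, and then `ν` is the exterior unit normal at `x`. -/
structure IsExteriorUnitNormal (Ω : Set E) (x ν : E) : Prop where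
  mem_frontier : x ∈ frontier Ω
  norm_eq_one : ‖ν‖ = 1
  tangent : (fun y => ⟪ν, y - x⟫_ℝ) =o[𝓝[frontier Ω] x] (fun y => y - x)
  exterior : ∀ᶠ t : ℝ in 𝓝[>] 0, x - t • ν ∈ Ω ∧ x + t • ν ∉ Ω

/-- A smooth vector field `Γ` on the whole space is transversal to the boundary of `Ω` if, at
the boundary points where the tangent plane exists, it has length one and its angle with the
exterior normal does not exceed a constant strictly smaller than `π / 2`. -/
structure IsTransversalField (Ω : Set E) (Γ : E → E) : Prop where
  smooth : ContDiff ℝ ∞ Γ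
  transversal : ∃ θ : ℝ, θ < Real.pi / 2 ∧ ∀ x ν : E, IsExteriorUnitNormal Ω x ν →
    ‖Γ x‖ = 1 ∧ InnerProductGeometry.angle (Γ x) ν ≤ θ

/-- `U` is an (open) interior collar neighborhood of the boundary of `Ω`: an open subset of `Ω`
that contains all points of `Ω` near the boundary, and such that the boundary together with `U` is
homeomorphic to `frontier Ω × [0, 1)`, by a homeomorphism that sends `(x, 0)` to `x`. -/
structure IsInteriorCollar (Ω U : Set E) : Prop where
  isOpen : IsOpen U
  subset : U ⊆ Ω
  mem_nhdsWithin : ∀ x ∈ frontier Ω, U ∈ 𝓝[Ω] x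
  exists_homeomorph : ∃ h : (frontier Ω × Ico (0 : ℝ) 1) ≃ₜ (frontier Ω ∪ U : Set E),
    ∀ x : frontier Ω, (h (x, ⟨0, by norm_num⟩) : E) = x

/-- `γ`, considered on the time interval `J`, is a maximal integral curve of `Γ` in `U`: `J` is a
nonempty open interval, `γ` solves `γ' = Γ(γ)` on `J` and stays in `U`, and it cannot be extended
to a strictly larger open interval as an integral curve of `Γ` staying in `U`. The values of `γ`
outside `J` are irrelevant. -/
structure IsMaximalIntegralCurveIn (Γ : E → E) (U : Set E) (γ : ℝ → E) (J : Set ℝ) : Prop where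
  nonempty : J.Nonempty
  isOpen : IsOpen J
  ordConnected : J.OrdConnected
  isIntegralCurveOn : IsIntegralCurveOn γ (fun _ => Γ) J
  mapsTo : MapsTo γ J U
  maximal : ∀ (γ' : ℝ → E) (J' : Set ℝ), IsOpen J' → J'.OrdConnected →
    IsIntegralCurveOn γ' (fun _ => Γ) J' → MapsTo γ' J' U → J ⊆ J' → EqOn γ γ' J → J' = J

/-- `S` is a smooth (embedded, without boundary) hypersurface: near each of its points it is the
zero set of a smooth real function whose differential at that point does not vanish. -/
def IsSmoothHypersurface (S : Set E) : Prop :=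
  ∀ p ∈ S, ∃ (V : Set E) (f : E → ℝ), IsOpen V ∧ p ∈ V ∧ ContDiffOn ℝ ∞ f V ∧
    fderiv ℝ f p ≠ 0 ∧ ∀ y ∈ V, (y ∈ S ↔ f y = 0)

/-- The tangent vectors of `S` at `p`: the velocities at `p` of curves that lie in `S`. For a
smooth hypersurface this is the kernel of the differential of a local defining function. -/
def tangentVectors (S : Set E) (p : E) : Set E :=
  {v | ∃ c : ℝ → E, c 0 = p ∧ (∀ᶠ t in 𝓝 0, c t ∈ S) ∧ HasDerivAt c v 0}

end LipschitzSurface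

/-! Let `b` be the distance to the complement of `Ω` and `X = -Γ`, after cutting `Γ` off outside
`closure Ω` so that `X` is bounded and Lipschitz and has a complete flow. The heart of the proof is
that near the boundary `b` grows at a definite rate `r` in every direction close to `X`.

Normals are given only where the local graph function `ψ` is differentiable. There, transversality
says that `ψ` rises more slowly than the height in the direction `X`, by a fixed margin. By
Rademacher's theorem and averaging over balls (`sub_le_of_fderiv_le`) the derivative bound becomes a
bound on increments everywhere, so `Ω` contains small cones around `X` (`exists_local_cone`).
Compactness makes the cones uniform, and `exists_infDist_growth` turns them into growth of `b`.

Growth of `b` along the flow gives the collar: flow lines enter `Ω` forward in time and leave its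
closure backward, so boundary point and time are coordinates on it. Growth in a whole cone of
directions survives mollification (`exists_contDiff_approx`), since nearby points see nearly the
same `X`. A smooth `F` close to `b` therefore increases along `X` at a level `a` away from the
boundary. The hypersurface is that level set in the collar: each flow line starts below `a`, ends
above it, and cannot come back once it has crossed. -/

namespace LipschitzSurface

/-! ### Complete flows of bounded Lipschitz vector fields -/

section Flow

variable {E : Type*} [NormedAddCommGroup E] [NormedSpace ℝ E]

/-- `φ` is the (complete) flow of the vector field `X`. -/
structure IsFlow (X : E → E) (φ : ℝ → E → E) : Prop where
  zero : ∀ x, φ 0 x = x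
  hasDerivAt : ∀ x t, HasDerivAt (fun s => φ s x) (X (φ t x)) t

lemma eqOn_Ioo_of_integralCurves {X : E → E} {K : NNReal} (hX : LipschitzWith K X)
    {f g : ℝ → E} {a b t₀ : ℝ} (ht₀ : t₀ ∈ Ioo a b)
    (hf : ∀ t ∈ Ioo a b, HasDerivAt f (X (f t)) t) (hg : ∀ t ∈ Ioo a b, HasDerivAt g (X (g t)) t)
    (h : f t₀ = g t₀) : EqOn f g (Ioo a b) :=
  ODE_solution_unique_of_mem_Ioo (v := fun _ => X) (s := fun _ => univ)
    (fun _ _ => hX.lipschitzOnWith) ht₀ (fun t ht => ⟨hf t ht, mem_univ _⟩)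
    (fun t ht => ⟨hg t ht, mem_univ _⟩) h

lemma exists_integralCurve_Ioo [CompleteSpace E] {X : E → E} {K M : NNReal}
    (hX : LipschitzWith K X) (hM : ∀ x, ‖X x‖ ≤ M) (x : E) (n : NNReal) :
    ∃ α : ℝ → E, α 0 = x ∧ ∀ t ∈ Ioo (-n : ℝ) n, HasDerivAt α (X (α t)) t := by
  have h0 : (0 : ℝ) ∈ Icc (-n : ℝ) n := by simp
  have hPL : IsPicardLindelof (fun _ => X) (tmin := (-n : ℝ)) (tmax := n) ⟨0, h0⟩ x
      (M * n) 0 M K :=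
    IsPicardLindelof.of_time_independent (fun y _ => hM y) hX.lipschitzOnWith (by simp)
  obtain ⟨α, h, hα⟩ := hPL.exists_eq_forall_mem_Icc_hasDerivWithinAt₀
  exact ⟨α, h, fun t ht => (hα t (Ioo_subset_Icc_self ht)).hasDerivAt (Icc_mem_nhds ht.1 ht.2)⟩

lemma exists_integralCurve [CompleteSpace E] {X : E → E} {K M : NNReal}
    (hX : LipschitzWith K X) (hM : ∀ x, ‖X x‖ ≤ M) (x : E) :
    ∃ α : ℝ → E, α 0 = x ∧ ∀ t, HasDerivAt α (X (α t)) t := by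
  choose α h0 hα using fun n : NNReal => exists_integralCurve_Ioo hX hM x n
  have key : ∀ m n : NNReal, 0 < m → m ≤ n → EqOn (α m) (α n) (Ioo (-m : ℝ) m) := by
    intro m n hm hmn
    have hmn' : (m : ℝ) ≤ n := by exact_mod_cast hmn
    refine eqOn_Ioo_of_integralCurves hX (t₀ := 0) (by simpa using hm) (hα m) (fun t ht => ?_)
      ((h0 m).trans (h0 n).symm)
    exact hα n t ⟨by linarith [ht.1], by linarith [ht.2]⟩
  -- The local solutions are glued by reading off at `t` one whose interval contains `t` in its
  -- interior. Near `t` this agrees with the single solution on radius `|t| + 2`, which yields the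
  -- derivative.
  refine ⟨fun t => α (‖t‖₊ + 1) t, h0 _, fun t => ?_⟩
  have ht : t ∈ Ioo (-((‖t‖₊ + 2 : NNReal) : ℝ)) ((‖t‖₊ + 2 : NNReal) : ℝ) := by
    simp only [NNReal.coe_add, coe_nnnorm, Real.norm_eq_abs, mem_Ioo]
    push_cast
    constructor <;> linarith [neg_abs_le t, le_abs_self t]
  have hev : (fun t => α (‖t‖₊ + 1) t) =ᶠ[𝓝 t] α (‖t‖₊ + 2) := by
    filter_upwards [Metric.ball_mem_nhds t one_pos] with s hs
    have hs' : |s - t| < 1 := by simpa [Real.dist_eq] using hs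
    have h1 : |s| ≤ |t| + 1 := by
      have := abs_sub_abs_le_abs_sub s t
      linarith
    refine key (‖s‖₊ + 1) (‖t‖₊ + 2) (by positivity) ?_ ?_
    · rw [← NNReal.coe_le_coe]
      push_cast
      rw [Real.norm_eq_abs, Real.norm_eq_abs]
      linarith
    · simp only [NNReal.coe_add, coe_nnnorm, Real.norm_eq_abs, mem_Ioo, NNReal.coe_one]
      constructor <;> linarith [neg_abs_le s, le_abs_self s]
  have := (hα _ t ht).congr_of_eventuallyEq hev
  rwa [← hev.eq_of_nhds] at this

lemma exists_isFlow [CompleteSpace E] {X : E → E} {K M : NNReal}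
    (hX : LipschitzWith K X) (hM : ∀ x, ‖X x‖ ≤ M) : ∃ φ : ℝ → E → E, IsFlow X φ := by
  choose α h0 hα using fun x => exists_integralCurve hX hM x
  exact ⟨fun t x => α x t, ⟨h0, hα⟩⟩

namespace IsFlow

variable {X : E → E} {φ : ℝ → E → E} {K : NNReal}

lemma continuous_time (h : IsFlow X φ) (x : E) : Continuous fun s => φ s x :=
  continuous_iff_continuousAt.2 fun t => (h.hasDerivAt x t).continuousAt

lemma hasDerivAt_shift (h : IsFlow X φ) (x : E) (c t : ℝ) :
    HasDerivAt (fun s => φ (s + c) x) (X (φ (t + c) x)) t := by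
  simpa using (h.hasDerivAt x (t + c)).comp_add_const t c

lemma eqOn_Ioo (h : IsFlow X φ) (hX : LipschitzWith K X) {γ : ℝ → E} {a b t₀ : ℝ}
    (ht₀ : t₀ ∈ Ioo a b) (hγ : ∀ t ∈ Ioo a b, HasDerivAt γ (X (γ t)) t) :
    ∀ t ∈ Ioo a b, γ t = φ (t - t₀) (γ t₀) := by
  refine eqOn_Ioo_of_integralCurves hX ht₀ hγ (fun t _ => ?_) (by simp [h.zero])
  simpa [sub_eq_add_neg] using h.hasDerivAt_shift (γ t₀) (-t₀) t

lemma add (h : IsFlow X φ) (hX : LipschitzWith K X) (s t : ℝ) (x : E) :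
    φ (s + t) x = φ s (φ t x) := by
  have := h.eqOn_Ioo hX (γ := fun s => φ (s + t) x) (a := -|s| - 1) (b := |s| + 1) (t₀ := 0)
    (by constructor <;> linarith [abs_nonneg s]) (fun r _ => h.hasDerivAt_shift x t r) s
    (by constructor <;> linarith [neg_abs_le s, le_abs_self s])
  simpa using this

lemma neg_apply (h : IsFlow X φ) (hX : LipschitzWith K X) (t : ℝ) (x : E) :
    φ (-t) (φ t x) = x := by
  rw [← h.add hX, neg_add_cancel, h.zero]

lemma apply_neg (h : IsFlow X φ) (hX : LipschitzWith K X) (t : ℝ) (x : E) :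
    φ t (φ (-t) x) = x := by
  rw [← h.add hX, add_neg_cancel, h.zero]

lemma reverse (h : IsFlow X φ) : IsFlow (fun x => -X x) fun t => φ (-t) where
  zero x := by simp [h.zero]
  hasDerivAt x t := by
    simpa [Function.comp_def] using (h.hasDerivAt x (-t)).scomp t (hasDerivAt_neg t)

lemma dist_le_of_nonneg (h : IsFlow X φ) (hX : LipschitzWith K X) {t : ℝ} (ht : 0 ≤ t) (x y : E) :
    dist (φ t x) (φ t y) ≤ dist x y * Real.exp (K * t) := by
  have := dist_le_of_trajectories_ODE (v := fun _ => X) (K := K) (f := fun s => φ s x)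
    (g := fun s => φ s y) (a := 0) (b := t) (δ := dist x y) (fun _ => hX)
    (h.continuous_time x).continuousOn (fun s _ => (h.hasDerivAt x s).hasDerivWithinAt)
    (h.continuous_time y).continuousOn (fun s _ => (h.hasDerivAt y s).hasDerivWithinAt)
    (by simp [h.zero]) t ⟨ht, le_rfl⟩
  simpa using this

lemma dist_le (h : IsFlow X φ) (hX : LipschitzWith K X) (t : ℝ) (x y : E) :
    dist (φ t x) (φ t y) ≤ dist x y * Real.exp (K * |t|) := by
  rcases le_total 0 t with ht | ht
  · simpa [abs_of_nonneg ht] using h.dist_le_of_nonneg hX ht x y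
  · simpa [abs_of_nonpos ht] using
      h.reverse.dist_le_of_nonneg (K := K) (t := -t) hX.neg (by linarith) x y

lemma norm_sub_le (h : IsFlow X φ) {M : ℝ} (hM : ∀ x, ‖X x‖ ≤ M) (s t : ℝ) (x : E) :
    ‖φ s x - φ t x‖ ≤ M * |s - t| := by
  simpa using convex_univ.norm_image_sub_le_of_norm_hasDerivWithin_le (f := fun s => φ s x)
    (fun r _ => (h.hasDerivAt x r).hasDerivWithinAt) (fun r _ => hM _) (mem_univ t) (mem_univ s)

lemma continuous (h : IsFlow X φ) (hX : LipschitzWith K X) :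
    Continuous fun p : ℝ × E => φ p.1 p.2 := by
  rw [continuous_iff_continuousAt]
  rintro ⟨t, x⟩
  rw [ContinuousAt, tendsto_iff_dist_tendsto_zero]
  have hlim : Tendsto (fun p : ℝ × E => dist p.2 x * Real.exp (K * |p.1|) +
      dist (φ p.1 x) (φ t x)) (𝓝 (t, x)) (𝓝 0) := by
    have hc : Continuous (fun p : ℝ × E => dist p.2 x * Real.exp (K * |p.1|) +
      dist (φ p.1 x) (φ t x)) := by
      have := h.continuous_time x
      fun_prop
    simpa using hc.tendsto (t, x)
  refine squeeze_zero (fun _ => dist_nonneg) (fun p => ?_) hlim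
  calc dist (φ p.1 p.2) (φ t x) ≤ dist (φ p.1 p.2) (φ p.1 x) + dist (φ p.1 x) (φ t x) :=
        dist_triangle _ _ _
    _ ≤ _ := by gcongr; exact h.dist_le hX _ _ _

/-- For short times the flow moves along a direction close to the field. -/
lemma exists_eq_add_smul (h : IsFlow X φ) (hX : LipschitzWith K X) {M : ℝ} (hM : ∀ x, ‖X x‖ ≤ M)
    {t : ℝ} (ht : 0 < t) (x : E) :
    ∃ w, φ t x = x + t • w ∧ ‖w - X x‖ ≤ K * M * t := by
  refine ⟨t⁻¹ • (φ t x - x), by rw [smul_inv_smul₀ ht.ne']; abel, ?_⟩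
  have hM0 : 0 ≤ M := (norm_nonneg _).trans (hM x)
  have key : ‖(φ t x - t • X x) - (φ 0 x - (0 : ℝ) • X x)‖ ≤ K * M * t * ‖t - 0‖ := by
    refine (convex_Icc 0 t).norm_image_sub_le_of_norm_hasDerivWithin_le
      (f := fun s => φ s x - s • X x) (f' := fun s => X (φ s x) - X x) (fun s _ => ?_)
      (fun s hs => ?_) ⟨le_rfl, ht.le⟩ ⟨ht.le, le_rfl⟩
    · simpa using ((h.hasDerivAt x s).fun_sub ((hasDerivAt_id s).smul_const (X x))).hasDerivWithinAt
    · have h1 := hX.dist_le_mul (φ s x) x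
      have h2 := h.norm_sub_le hM s 0 x
      rw [h.zero, sub_zero, abs_of_nonneg hs.1] at h2
      rw [dist_eq_norm, dist_eq_norm] at h1
      calc ‖X (φ s x) - X x‖ ≤ K * ‖φ s x - x‖ := h1
        _ ≤ K * (M * t) := by
          gcongr
          exact h2.trans (mul_le_mul_of_nonneg_left hs.2 hM0)
        _ = K * M * t := by ring
  rw [h.zero, zero_smul, sub_zero, sub_zero, Real.norm_eq_abs, abs_of_pos ht] at key
  have heq : t⁻¹ • (φ t x - x) - X x = t⁻¹ • (φ t x - t • X x - x) := by
    rw [smul_sub, smul_sub, smul_sub, inv_smul_smul₀ ht.ne']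
    abel
  rw [heq, norm_smul, norm_inv, Real.norm_eq_abs, abs_of_pos ht, inv_mul_le_iff₀ ht]
  linarith

end IsFlow

end Flow

/-! ### From derivative bounds at points of differentiability to bounds on increments -/

section AEGradient

variable {F : Type*} [NormedAddCommGroup F] [NormedSpace ℝ F] [FiniteDimensional ℝ F]

open MeasureTheory in
/-- The mean of the increment of a Lipschitz function over a ball is controlled by an almost
everywhere bound on the directional derivative along the way. -/
lemma setIntegral_sub_le_of_ae_fderiv_le [MeasurableSpace F] [BorelSpace F] {μ : Measure F}
    [μ.IsAddHaarMeasure] {ψ : F → ℝ} {K : NNReal} (hψ : LipschitzWith K ψ) {u : F} {m : ℝ}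
    {s : Set F} (hs : ∀ᵐ q ∂μ, q ∈ s → DifferentiableAt ℝ ψ q → fderiv ℝ ψ q u ≤ m)
    {B : Set F} (hBm : MeasurableSet B) (hBb : Bornology.IsBounded B) {t : ℝ} (ht : 0 ≤ t)
    (hB : ∀ x ∈ B, ∀ r ∈ Icc 0 t, x + r • u ∈ s) :
    ∫ x in B, (ψ (x + t • u) - ψ x) ∂μ ≤ ∫ _ in B, t * m ∂μ := by
  have hfin : μ B < ⊤ := hBb.measure_lt_top
  have : IsFiniteMeasure (μ.restrict B) := ⟨by simpa using hfin⟩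
  have hint : ∀ r : ℝ, Integrable (fun x => ψ (x + r • u)) (μ.restrict B) := fun r => by
    have hc : Continuous fun x => ψ (x + r • u) := hψ.continuous.comp (by fun_prop)
    exact (hc.continuousOn.integrableOn_compact hBb.isCompact_closure).mono_set subset_closure
  -- A single line may consist of points where `ψ` is not differentiable. For each fixed `r`,
  -- however, almost every `x + r • u` is good, so the average `I` is differentiable everywhere and
  -- the mean value inequality applies to it.
  set I : ℝ → ℝ := fun r => ∫ x in B, ψ (x + r • u) ∂μ with hI
  have hdiff : ∀ r : ℝ, ∀ᵐ x ∂(μ.restrict B), DifferentiableAt ℝ ψ (x + r • u) := fun r =>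
    ae_restrict_of_ae ((measurePreserving_add_right μ (r • u)).quasiMeasurePreserving.ae
      (hψ.ae_differentiableAt (μ := μ)))
  have hder : ∀ r : ℝ, Integrable (fun x => fderiv ℝ ψ (x + r • u) u) (μ.restrict B) ∧
      HasDerivAt I (∫ x in B, fderiv ℝ ψ (x + r • u) u ∂μ) r := by
    intro r
    refine hasDerivAt_integral_of_dominated_loc_of_lip (F := fun r x => ψ (x + r • u))
      (bound := fun _ => K * ‖u‖) (s := univ) univ_mem
      (Eventually.of_forall fun r => (hint r).aestronglyMeasurable) (hint r) ?_ ?_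
      (integrable_const _) ?_
    · exact ((measurable_fderiv_apply_const ℝ ψ u).comp
        (measurable_add_const (r • u))).aestronglyMeasurable
    · refine Eventually.of_forall fun x => LipschitzWith.lipschitzOnWith ?_
      refine LipschitzWith.of_dist_le_mul fun a b => ?_
      refine (hψ.dist_le_mul _ _).trans ?_
      rw [dist_add_left, dist_eq_norm, ← sub_smul, norm_smul, Real.coe_nnabs,
        abs_of_nonneg (by positivity), dist_eq_norm]
      exact le_of_eq (by ring)
    · filter_upwards [hdiff r] with x hx
      have h1 : HasDerivAt (fun r : ℝ => x + r • u) u r := by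
        simpa using ((hasDerivAt_id r).smul_const u).const_add x
      exact hx.hasFDerivAt.comp_hasDerivAt r h1
  have hle : ∀ r ∈ interior (Icc 0 t), deriv I r ≤ ∫ _ in B, m ∂μ := by
    intro r hr
    rw [(hder r).2.deriv]
    refine integral_mono_ae (hder r).1 (integrable_const _) ?_
    have h1 := (measurePreserving_add_right μ (r • u)).quasiMeasurePreserving.ae hs
    filter_upwards [hdiff r, ae_restrict_of_ae h1, ae_restrict_mem hBm] with x hx hx' hxB
    exact hx' (hB x hxB r (interior_subset hr)) hx
  have := (convex_Icc 0 t).image_sub_le_mul_sub_of_deriv_le (f := I)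
    (fun r _ => (hder r).2.continuousAt.continuousWithinAt)
    (fun r _ => (hder r).2.differentiableAt.differentiableWithinAt) hle 0 ⟨le_rfl, ht⟩ t
    ⟨ht, le_rfl⟩ ht
  have h0 : ∫ x in B, (ψ (x + t • u) - ψ x) ∂μ = I t - I 0 := by
    rw [integral_sub (hint t) (by simpa using hint 0)]
    simp [hI]
  rw [h0, integral_const_mul]
  linarith

open MeasureTheory in
/-- A Lipschitz function whose derivative in a direction `u` is at most `m` wherever it exists in
a ball grows in the direction `u` at most with slope `m` inside the ball. -/
lemma sub_le_of_fderiv_le {ψ : F → ℝ} {K : NNReal} (hψ : LipschitzWith K ψ) {u : F} {m : ℝ}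
    {q₀ : F} {ρ : ℝ}
    (h : ∀ q ∈ Metric.ball q₀ ρ, DifferentiableAt ℝ ψ q → fderiv ℝ ψ q u ≤ m)
    {q : F} {t : ℝ} (ht : 0 ≤ t) (hq : q ∈ Metric.ball q₀ ρ) (hqt : q + t • u ∈ Metric.ball q₀ ρ) :
    ψ (q + t • u) - ψ q ≤ t * m := by
  borelize F
  set μ : Measure F := Measure.addHaar
  -- A violation at `q` is an open condition, hence holds on a small ball around `q`; integrating
  -- over that ball contradicts the averaged bound.
  by_contra! hlt
  have hcont : Continuous fun x => ψ (x + t • u) - ψ x :=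
    (hψ.continuous.comp (by fun_prop)).sub hψ.continuous
  have h1 : ∀ᶠ x in 𝓝 q, t * m < ψ (x + t • u) - ψ x := hcont.continuousAt.eventually_const_lt hlt
  have h2 : ∀ᶠ x in 𝓝 q, x ∈ Metric.ball q₀ ρ := Metric.isOpen_ball.mem_nhds hq
  have h3 : ∀ᶠ x in 𝓝 q, x + t • u ∈ Metric.ball q₀ ρ :=
    (continuous_id.add continuous_const).continuousAt.eventually_mem
      (Metric.isOpen_ball.mem_nhds hqt)
  obtain ⟨η, hη, hball⟩ := Metric.eventually_nhds_iff_ball.1 (h1.and (h2.and h3))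
  have hseg : ∀ x ∈ Metric.ball q η, ∀ r ∈ Icc 0 t, x + r • u ∈ Metric.ball q₀ ρ := by
    intro x hx r hr
    rcases ht.eq_or_lt with h0 | h0
    · have : r = 0 := le_antisymm (h0 ▸ hr.2) hr.1
      simpa [this] using (hball x hx).2.1
    · have := (convex_ball q₀ ρ).add_smul_sub_mem (hball x hx).2.1 (hball x hx).2.2
        (t := r / t) ⟨div_nonneg hr.1 ht, (div_le_one h0).2 hr.2⟩
      rwa [add_sub_cancel_left, smul_smul, div_mul_cancel₀ _ h0.ne'] at this
  have key := setIntegral_sub_le_of_ae_fderiv_le (μ := μ) hψ (Eventually.of_forall h)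
    Metric.isOpen_ball.measurableSet Metric.isBounded_ball ht hseg
  refine key.not_gt ?_
  have hfin : μ (Metric.ball q η) < ⊤ := Metric.isBounded_ball.measure_lt_top
  rw [← sub_pos, ← integral_sub]
  · rw [setIntegral_pos_iff_support_of_nonneg_ae]
    · refine (Metric.measure_ball_pos μ q hη).trans_le (measure_mono fun x hx => ⟨?_, hx⟩)
      exact (sub_pos.2 (hball x hx).1).ne'
    · filter_upwards [ae_restrict_mem Metric.isOpen_ball.measurableSet] with x hx
      exact (sub_pos.2 (hball x hx).1).le
    · exact (((hcont.sub continuous_const).continuousOn).integrableOn_compact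
        Metric.isBounded_ball.isCompact_closure).mono_set subset_closure
  · exact (hcont.continuousOn.integrableOn_compact
        Metric.isBounded_ball.isCompact_closure).mono_set subset_closure
  · exact integrableOn_const hfin.ne

end AEGradient

/-! ### Exterior normals of a domain above a graph -/

section Graph

variable {E : Type*} [NormedAddCommGroup E] [InnerProductSpace ℝ E] {e : E}

lemma inner_self_eq_one_of_norm (he : ‖e‖ = 1) : ⟪e, e⟫_ℝ = 1 := by
  rw [real_inner_self_eq_norm_sq, he, one_pow]

lemma inner_coe_orthogonal_singleton (q : ((ℝ ∙ e)ᗮ : Submodule ℝ E)) : ⟪e, (q : E)⟫_ℝ = 0 :=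
  Submodule.mem_orthogonal_singleton_iff_inner_right.1 q.2

lemma projection_add_smul (q : ((ℝ ∙ e)ᗮ : Submodule ℝ E)) (s : ℝ) :
    (ℝ ∙ e)ᗮ.orthogonalProjectionOnto ((q : E) + s • e) = q := by
  rw [map_add, map_smul, Submodule.orthogonalProjectionOnto_mem_subspace_eq_self,
    Submodule.orthogonalProjectionOnto_orthogonalComplement_singleton_eq_zero, smul_zero, add_zero]

lemma inner_add_smul (he : ‖e‖ = 1) (q : ((ℝ ∙ e)ᗮ : Submodule ℝ E)) (s : ℝ) :
    ⟪e, (q : E) + s • e⟫_ℝ = s := by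
  rw [inner_add_right, inner_coe_orthogonal_singleton, inner_smul_right,
    inner_self_eq_one_of_norm he]
  ring

lemma projection_add_inner_smul (he : ‖e‖ = 1) (y : E) :
    ((ℝ ∙ e)ᗮ.orthogonalProjectionOnto y : E) + ⟪e, y⟫_ℝ • e = y := by
  have h := Submodule.starProjection_add_starProjection_orthogonal (K := ℝ ∙ e) y
  rw [Submodule.starProjection_unit_singleton ℝ he] at h
  rw [add_comm]
  exact h

lemma norm_projection_le (y : E) : ‖(ℝ ∙ e)ᗮ.orthogonalProjectionOnto y‖ ≤ ‖y‖ :=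
  Submodule.norm_orthogonalProjectionOnto_apply_le _ y

lemma eventually_right_of_hasDerivAt_pos {k : ℝ → ℝ} {k' : ℝ} (h : HasDerivAt k k' 0)
    (hk : 0 < k') : ∀ᶠ s in 𝓝[>] (0 : ℝ), k 0 < k s ∧ k (-s) < k 0 := by
  have hs := hasDerivAt_iff_tendsto_slope.1 h
  have hev : ∀ᶠ s in 𝓝[≠] (0 : ℝ), 0 < slope k 0 s := hs.eventually_const_lt hk
  have hr : ∀ᶠ s in 𝓝[>] (0 : ℝ), 0 < slope k 0 s :=
    hev.filter_mono (nhdsWithin_mono 0 fun s hs => ne_of_gt hs)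
  have hneg : Tendsto (fun s : ℝ => -s) (𝓝[>] 0) (𝓝[≠] 0) := by
    refine tendsto_nhdsWithin_iff.2 ⟨?_, ?_⟩
    · simpa using (continuous_neg.tendsto (0 : ℝ)).mono_left nhdsWithin_le_nhds
    · filter_upwards [self_mem_nhdsWithin] with s hs
      simpa using ne_of_gt (mem_Ioi.1 hs)
  filter_upwards [hr, hneg.eventually hev, self_mem_nhdsWithin] with s h1 h2 hs
  have hs : 0 < s := hs
  rw [slope_def_field] at h1 h2
  constructor
  · by_contra! h
    exact h1.not_ge (div_nonpos_of_nonpos_of_nonneg (by linarith) (by linarith))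
  · by_contra! h
    exact h2.not_ge (div_nonpos_of_nonneg_of_nonpos (by linarith) (by linarith))

variable {Ω V : Set E} {ψ : ((ℝ ∙ e)ᗮ : Submodule ℝ E) → ℝ}

lemma eq_of_mem_frontier_of_graph (hΩ : IsOpen Ω) (hψ : Continuous ψ) (hV : IsOpen V)
    (hg : ∀ y ∈ V, (y ∈ Ω ↔ ψ ((ℝ ∙ e)ᗮ.orthogonalProjectionOnto y) < ⟪e, y⟫_ℝ))
    {y : E} (hy : y ∈ frontier Ω) (hyV : y ∈ V) :
    ψ ((ℝ ∙ e)ᗮ.orthogonalProjectionOnto y) = ⟪e, y⟫_ℝ := by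
  rw [hΩ.frontier_eq] at hy
  refine le_antisymm ?_ (not_lt.1 fun h => hy.2 ((hg y hyV).2 h))
  by_contra! hlt
  have hc : Continuous fun z => ψ ((ℝ ∙ e)ᗮ.orthogonalProjectionOnto z) := by fun_prop
  have hc' : Continuous fun z : E => ⟪e, z⟫_ℝ := by fun_prop
  obtain ⟨z, ⟨hz, hzV⟩, hzΩ⟩ := mem_closure_iff_nhds.1 hy.1 _
    (inter_mem ((isOpen_lt hc' hc).mem_nhds hlt) (hV.mem_nhds hyV))
  exact lt_asymm hz ((hg z hzV).1 hzΩ)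

/-- The graph is the zero set of `ψ - height`, which is negative in `Ω` and has gradient `n - e`;
the tangency condition is the first-order expansion of `ψ` at `q` restricted to the graph. -/
lemma isExteriorUnitNormal_of_graph (hΩ : IsOpen Ω) (he : ‖e‖ = 1) (hψ : Continuous ψ)
    (hV : IsOpen V)
    (hg : ∀ y ∈ V, (y ∈ Ω ↔ ψ ((ℝ ∙ e)ᗮ.orthogonalProjectionOnto y) < ⟪e, y⟫_ℝ))
    {q n : ((ℝ ∙ e)ᗮ : Submodule ℝ E)} (hx : (q : E) + ψ q • e ∈ V)
    (hd : HasFDerivAt ψ (innerSL ℝ n) q) :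
    IsExteriorUnitNormal Ω ((q : E) + ψ q • e) (‖(n : E) - e‖⁻¹ • ((n : E) - e)) := by
  set x : E := (q : E) + ψ q • e with hxdef
  set N : E := (n : E) - e with hN
  have hee := inner_self_eq_one_of_norm he
  have hNe : ⟪e, N⟫_ℝ = -1 := by
    rw [hN, inner_sub_right, inner_coe_orthogonal_singleton, hee]
    ring
  have hN0 : N ≠ 0 := by
    rintro h
    rw [h, inner_zero_right] at hNe
    norm_num at hNe
  have hNpos : 0 < ‖N‖ := norm_pos_iff.2 hN0
  have hPx : (ℝ ∙ e)ᗮ.orthogonalProjectionOnto x = q := projection_add_smul q _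
  have hxe : ⟪e, x⟫_ℝ = ψ q := inner_add_smul he q _
  have hNeq : ∀ s : ℝ, x + s • N = ((q + s • n : ((ℝ ∙ e)ᗮ : Submodule ℝ E)) : E) +
      (ψ q - s) • e := by
    intro s
    rw [hxdef, hN, Submodule.coe_add, Submodule.coe_smul, smul_sub, sub_smul]
    abel
  have hside : ∀ᶠ s in 𝓝[>] (0 : ℝ), x - s • N ∈ Ω ∧ x + s • N ∉ Ω := by
    -- Up to the constant `ψ q`, this is `ψ - height` along `x + s • N`. Its positive derivative
    -- decides on which side of the graph the points lie.
    have hk : HasDerivAt (fun s : ℝ => ψ (q + s • n) + s) (⟪n, n⟫_ℝ + 1) 0 := by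
      have h1 : HasDerivAt (fun s : ℝ => q + s • n) n 0 := by
        simpa using ((hasDerivAt_id (0 : ℝ)).smul_const n).const_add q
      have h2 : HasFDerivAt ψ (innerSL ℝ n) (q + (0 : ℝ) • n) := by simpa using hd
      exact (h2.comp_hasDerivAt 0 h1).add (hasDerivAt_id 0)
    have hpos : 0 < ⟪n, n⟫_ℝ + 1 := by
      have := real_inner_self_nonneg (x := n)
      linarith
    have hcont : Continuous fun s : ℝ => x + s • N := by fun_prop
    have hcont' : Continuous fun s : ℝ => x - s • N := by fun_prop
    have hv1 : ∀ᶠ s in 𝓝[>] (0 : ℝ), x + s • N ∈ V :=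
      (hcont.continuousAt.eventually_mem (hV.mem_nhds (by simpa using hx))).filter_mono
        nhdsWithin_le_nhds
    have hv2 : ∀ᶠ s in 𝓝[>] (0 : ℝ), x - s • N ∈ V :=
      (hcont'.continuousAt.eventually_mem (hV.mem_nhds (by simpa using hx))).filter_mono
        nhdsWithin_le_nhds
    filter_upwards [eventually_right_of_hasDerivAt_pos hk hpos, hv1, hv2] with s hs h1 h2
    simp only [zero_smul, add_zero] at hs
    constructor
    · rw [hg _ h2, sub_eq_add_neg, ← neg_smul, hNeq, projection_add_smul, inner_add_smul he]
      linarith [hs.2]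
    · rw [hg _ h1, hNeq, projection_add_smul, inner_add_smul he, not_lt]
      linarith [hs.1]
  refine ⟨?_, ?_, ?_, ?_⟩
  · rw [hΩ.frontier_eq]
    refine ⟨?_, ?_⟩
    · have hlim : Tendsto (fun s : ℝ => x - s • N) (𝓝[>] 0) (𝓝 x) := by
        have hcont' : Continuous fun s : ℝ => x - s • N := by fun_prop
        simpa using (hcont'.tendsto 0).mono_left nhdsWithin_le_nhds
      exact mem_closure_of_tendsto hlim (hside.mono fun s hs => hs.1)
    · rw [hg x hx, hPx, hxe]
      exact lt_irrefl _
  · rw [norm_smul, norm_inv, norm_norm, inv_mul_cancel₀ hNpos.ne']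
  · have hP : Tendsto (fun y : E => (ℝ ∙ e)ᗮ.orthogonalProjectionOnto y) (𝓝[frontier Ω] x)
        (𝓝 q) := by
      rw [← hPx]
      exact (ContinuousLinearMap.continuous _).continuousWithinAt
    have h1 := (hasFDerivAt_iff_isLittleO.1 hd).comp_tendsto hP
    have h2 : (fun y : E => (ℝ ∙ e)ᗮ.orthogonalProjectionOnto y - q) =O[𝓝[frontier Ω] x]
        fun y => y - x := by
      refine Asymptotics.IsBigO.of_bound 1 (Eventually.of_forall fun y => ?_)
      rw [one_mul, ← hPx, ← map_sub]
      exact norm_projection_le _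
    have h3 := (h1.trans_isBigO h2).const_mul_left (-‖N‖⁻¹)
    refine h3.congr' ?_ EventuallyEq.rfl
    filter_upwards [self_mem_nhdsWithin, nhdsWithin_le_nhds (hV.mem_nhds hx)] with y hy hyV
    have hyg := eq_of_mem_frontier_of_graph hΩ hψ hV hg hy hyV
    have hyx : ⟪N, y - x⟫_ℝ =
        ⟪n, (ℝ ∙ e)ᗮ.orthogonalProjectionOnto y - q⟫_ℝ - (⟪e, y⟫_ℝ - ψ q) := by
      rw [hN, inner_sub_left, inner_sub_right e, hxe, ← hPx, ← map_sub,
        ← Submodule.inner_orthogonalProjectionOnto_eq_of_mem_left]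
    simp only [Function.comp_apply, hyg, innerSL_apply_apply]
    rw [real_inner_smul_left, hyx]
    ring
  · have hsc : Tendsto (fun t : ℝ => t * ‖N‖⁻¹) (𝓝[>] 0) (𝓝[>] 0) := by
      refine tendsto_nhdsWithin_iff.2 ⟨?_, ?_⟩
      · have : Continuous fun t : ℝ => t * ‖N‖⁻¹ := by fun_prop
        simpa using (this.tendsto 0).mono_left nhdsWithin_le_nhds
      · filter_upwards [self_mem_nhdsWithin] with t ht
        exact mul_pos ht (inv_pos.2 hNpos)
    filter_upwards [hsc.eventually hside] with t ht
    simpa only [smul_smul] using ht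

lemma IsTransversalField.exists_le_inner {Γ : E → E} (hΓ : IsTransversalField Ω Γ) :
    ∃ c > 0, ∀ x ν, IsExteriorUnitNormal Ω x ν → c ≤ ⟪Γ x, ν⟫_ℝ := by
  obtain ⟨θ, hθ, h⟩ := hΓ.transversal
  -- Nothing bounds `θ` from below, so it is replaced by `max θ 0` to keep the cosine positive.
  refine ⟨Real.cos (max θ 0), Real.cos_pos_of_mem_Ioo ⟨?_, ?_⟩, fun x ν hν => ?_⟩
  · exact lt_of_lt_of_le (by linarith [Real.pi_pos]) (le_max_right _ _)
  · exact max_lt hθ (by linarith [Real.pi_pos])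
  · obtain ⟨h1, h2⟩ := h x ν hν
    rw [← InnerProductGeometry.cos_angle_mul_norm_mul_norm, h1, hν.norm_eq_one, mul_one, mul_one]
    refine Real.cos_le_cos_of_nonneg_of_le_pi (InnerProductGeometry.angle_nonneg _ _) ?_
      (h2.trans (le_max_left _ _))
    exact max_le (by linarith [Real.pi_pos]) Real.pi_pos.le

end Graph

/-! ### Interior cones, and growth of the distance to the complement -/

section Cone

variable {E : Type*} [NormedAddCommGroup E] [InnerProductSpace ℝ E] {Ω : Set E}

/-- Transversality at points of differentiability bounds the slope of `ψ` in the direction `P w₀` by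
that of the height minus `c / 2`. Integrated, this keeps `y + t • w₀` above the graph, and the
margin absorbs small changes of `w₀`. -/
lemma exists_local_cone [FiniteDimensional ℝ E] (hΩ : IsOpen Ω) (hL : HasLipschitzBoundary Ω)
    {Γ : E → E} (hΓ : Continuous Γ) {c : ℝ} (hc : 0 < c)
    (htr : ∀ x ν, IsExteriorUnitNormal Ω x ν → c ≤ ⟪Γ x, ν⟫_ℝ) {x₀ : E} (hx₀ : x₀ ∈ frontier Ω) :
    ∃ r > 0, ∀ y ∈ Ω, y ∈ Metric.ball x₀ r → ∀ t ∈ Icc 0 r, ∀ w, ‖w - -Γ x₀‖ ≤ r →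
      y + t • w ∈ Ω := by
  obtain ⟨e, K, ψ, V, he, hψ, hV, hxV, hg⟩ := hL x₀ hx₀
  set P := (ℝ ∙ e)ᗮ.orthogonalProjectionOnto with hP
  set w₀ : E := -Γ x₀ with hw₀
  have hx₀' : (P x₀ : E) + ψ (P x₀) • e = x₀ := by
    rw [eq_of_mem_frontier_of_graph hΩ hψ.continuous hV hg hx₀ hxV]
    exact projection_add_inner_smul he x₀
  have hG : Continuous fun q : ((ℝ ∙ e)ᗮ : Submodule ℝ E) => (q : E) + ψ q • e := by
    have := hψ.continuous
    fun_prop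
  have hGt : Tendsto (fun q : ((ℝ ∙ e)ᗮ : Submodule ℝ E) => (q : E) + ψ q • e) (𝓝 (P x₀))
      (𝓝 x₀) := by
    simpa only [hx₀'] using hG.tendsto (P x₀)
  have hK1 : (0 : ℝ) < K + 1 := by positivity
  have hnear : ∀ᶠ x in 𝓝 x₀, ‖Γ x - Γ x₀‖ < c / (2 * (K + 1)) := by
    have h1 : Continuous fun x => ‖Γ x - Γ x₀‖ := by fun_prop
    refine h1.continuousAt.eventually_lt_const ?_
    simp only [sub_self, norm_zero]
    positivity
  obtain ⟨ρ, hρ, hball⟩ := Metric.eventually_nhds_iff_ball.1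
    (hGt.eventually (hnear.and (hV.mem_nhds hxV)))
  have hderiv : ∀ q ∈ Metric.ball (P x₀) ρ, DifferentiableAt ℝ ψ q →
      fderiv ℝ ψ q (P w₀) ≤ ⟪e, w₀⟫_ℝ - c / 2 := by
    intro q hq hd
    obtain ⟨hΓq, hqV⟩ := hball q hq
    obtain ⟨n, hn⟩ : ∃ n, innerSL ℝ n = fderiv ℝ ψ q :=
      ⟨_, (InnerProductSpace.toDual ℝ ((ℝ ∙ e)ᗮ : Submodule ℝ E)).apply_symm_apply (fderiv ℝ ψ q)⟩
    have hnK : ‖n‖ ≤ K := by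
      have := norm_fderiv_le_of_lipschitz ℝ hψ (x₀ := q)
      rwa [← hn, innerSL_apply_norm] at this
    have hnu := htr _ _ (isExteriorUnitNormal_of_graph hΩ he hψ.continuous hV hg hqV
      (hn ▸ hd.hasFDerivAt))
    set x : E := (q : E) + ψ q • e
    set N : E := (n : E) - e with hN
    have hNe : ⟪N, e⟫_ℝ = -1 := by
      rw [hN, inner_sub_left, real_inner_comm, inner_coe_orthogonal_singleton,
        inner_self_eq_one_of_norm he]
      ring
    have hN1 : 1 ≤ ‖N‖ := by
      have := abs_real_inner_le_norm N e
      rwa [hNe, he, mul_one, abs_neg, abs_one] at this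
    have hNK : ‖N‖ ≤ K + 1 := by
      calc ‖N‖ ≤ ‖(n : E)‖ + ‖e‖ := norm_sub_le _ _
        _ ≤ K + 1 := by
          rw [he]
          gcongr
          exact hnK
    -- Since `‖N‖ ≥ 1`, the bound for the unit normal only improves when the normalization is
    -- removed.
    have h1 : c ≤ ⟪N, Γ x⟫_ℝ := by
      rw [real_inner_smul_right, real_inner_comm, ← div_eq_inv_mul,
        le_div_iff₀ (by linarith)] at hnu
      nlinarith
    have h2 : ⟪N, Γ x - Γ x₀⟫_ℝ ≤ c / 2 := by
      calc ⟪N, Γ x - Γ x₀⟫_ℝ ≤ ‖N‖ * ‖Γ x - Γ x₀‖ := real_inner_le_norm _ _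
        _ ≤ (K + 1) * (c / (2 * (K + 1))) := by gcongr
        _ = c / 2 := by field_simp
    have h3 : ⟪N, w₀⟫_ℝ = fderiv ℝ ψ q (P w₀) - ⟪e, w₀⟫_ℝ := by
      rw [hN, inner_sub_left, ← hn, innerSL_apply_apply,
        ← Submodule.inner_orthogonalProjectionOnto_eq_of_mem_left]
    have h4 : ⟪N, w₀⟫_ℝ = ⟪N, Γ x - Γ x₀⟫_ℝ - ⟪N, Γ x⟫_ℝ := by
      rw [hw₀, inner_sub_right, inner_neg_right]
      ring
    linarith
  obtain ⟨ε, hε, hεV⟩ := Metric.mem_nhds_iff.1 (hV.mem_nhds hxV)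
  set δ := min ε ρ
  have hδ : 0 < δ := lt_min hε hρ
  have hw₀3 : 0 < 3 + ‖w₀‖ := by positivity
  -- The second bound keeps the segments inside the chart. The third pays for a change of direction
  -- by `r`, which costs `K * r` in `ψ` and `r` in the height per unit time.
  obtain ⟨r, hr, hr1, hr2, hr3⟩ : ∃ r > 0, r ≤ 1 ∧ r * (3 + ‖w₀‖) ≤ δ ∧ r * (K + 1) ≤ c / 2 := by
    refine ⟨min 1 (min (δ / (3 + ‖w₀‖)) (c / 2 / (K + 1))), by positivity, min_le_left _ _, ?_, ?_⟩
    · rw [← le_div_iff₀ hw₀3]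
      exact (min_le_right _ _).trans (min_le_left _ _)
    · rw [← le_div_iff₀ hK1]
      exact (min_le_right _ _).trans (min_le_right _ _)
  refine ⟨r, hr, fun y hyΩ hy t ht w hw => ?_⟩
  rw [mem_ball_iff_norm] at hy
  have hclose : ∀ v : E, ‖v - w₀‖ ≤ r → ‖y + t • v - x₀‖ < δ := by
    intro v hv
    have hv' : ‖v‖ ≤ ‖w₀‖ + 1 := by
      have := norm_le_insert w₀ v
      rw [norm_sub_rev] at this
      linarith
    calc ‖y + t • v - x₀‖ = ‖(y - x₀) + t • v‖ := by congr 1; abel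
      _ ≤ ‖y - x₀‖ + ‖t • v‖ := norm_add_le _ _
      _ ≤ ‖y - x₀‖ + r * (‖w₀‖ + 1) := by
        rw [norm_smul, Real.norm_eq_abs, abs_of_nonneg ht.1]
        gcongr
        exact ht.2
      _ < r * (3 + ‖w₀‖) := by nlinarith
      _ ≤ δ := hr2
  have hyδ : ‖y - x₀‖ < δ := by nlinarith [norm_nonneg w₀]
  have hPball : ∀ z : E, ‖z - x₀‖ < δ → P z ∈ Metric.ball (P x₀) ρ := by
    intro z hz
    rw [mem_ball_iff_norm, ← map_sub]
    exact (norm_projection_le _).trans_lt (hz.trans_le (min_le_right _ _))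
  have hVmem : ∀ z : E, ‖z - x₀‖ < δ → z ∈ V := fun z hz =>
    hεV (mem_ball_iff_norm.2 (hz.trans_le (min_le_left _ _)))
  have hw₀ball := hPball _ (hclose w₀ (by simpa using hr.le))
  rw [map_add, map_smul] at hw₀ball
  have h1 := sub_le_of_fderiv_le hψ hderiv ht.1 (hPball y hyδ) hw₀ball
  rw [hg _ (hVmem _ (hclose w hw))]
  have h2 : ψ (P (y + t • w)) ≤ ψ (P y + t • P w₀) + K * (t * r) := by
    have h := hψ.dist_le_mul (P (y + t • w)) (P y + t • P w₀)
    have h' : ‖P (y + t • w) - (P y + t • P w₀)‖ ≤ t * r := by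
      have : P (y + t • w) - (P y + t • P w₀) = t • P (w - w₀) := by
        rw [map_add, map_smul, map_sub, smul_sub]
        abel
      rw [this, norm_smul, Real.norm_eq_abs, abs_of_nonneg ht.1]
      exact mul_le_mul_of_nonneg_left ((norm_projection_le _).trans hw) ht.1
    rw [Real.dist_eq, dist_eq_norm] at h
    have h'' := mul_le_mul_of_nonneg_left h' K.coe_nonneg
    linarith [le_abs_self (ψ (P (y + t • w)) - ψ (P y + t • P w₀))]
  have h3 : ⟪e, w₀⟫_ℝ - r ≤ ⟪e, w⟫_ℝ := by
    have := abs_real_inner_le_norm e (w - w₀)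
    rw [he, one_mul, inner_sub_right] at this
    linarith [neg_abs_le (⟪e, w⟫_ℝ - ⟪e, w₀⟫_ℝ)]
  have h4 := (hg y (hVmem y hyδ)).1 hyΩ
  rw [inner_add_right, inner_smul_right]
  have h5 := mul_le_mul_of_nonneg_left h3 ht.1
  have h6 := mul_le_mul_of_nonneg_left hr3 ht.1
  nlinarith

/-- Compactness of the boundary gives one radius for all boundary points. Continuity of `X` allows
the cone axis to be taken at `y` itself, so that the result no longer refers to a boundary point. -/
lemma exists_uniform_cone [FiniteDimensional ℝ E] (hb : Bornology.IsBounded Ω) (hΩ : Ω ≠ univ)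
    {X : E → E} (hX : Continuous X)
    (hloc : ∀ x ∈ frontier Ω, ∃ r > 0, ∀ y ∈ Ω, y ∈ Metric.ball x r → ∀ t ∈ Icc 0 r, ∀ w,
      ‖w - X x‖ ≤ r → y + t • w ∈ Ω) :
    ∃ r > 0, ∀ y ∈ Ω, Metric.infDist y Ωᶜ < r → ∀ t ∈ Icc 0 r, ∀ w, ‖w - X y‖ ≤ r →
      y + t • w ∈ Ω := by
  have hcomp : IsCompact (frontier Ω) :=
    Metric.isCompact_of_isClosed_isBounded isClosed_frontier
      (hb.closure.subset frontier_subset_closure)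
  have hunif : ∃ r > 0, ∀ x ∈ frontier Ω, ∀ y ∈ Ω, y ∈ Metric.ball x r → ∀ t ∈ Icc 0 r, ∀ w,
      ‖w - X y‖ ≤ r → y + t • w ∈ Ω := by
    refine hcomp.induction_on (p := fun s => ∃ r > 0, ∀ x ∈ s, ∀ y ∈ Ω, y ∈ Metric.ball x r →
      ∀ t ∈ Icc 0 r, ∀ w, ‖w - X y‖ ≤ r → y + t • w ∈ Ω) ⟨1, one_pos, by simp⟩ ?_ ?_ ?_
    · rintro s t hst ⟨r, hr, h⟩
      exact ⟨r, hr, fun x hx => h x (hst hx)⟩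
    · rintro s t ⟨r₁, hr₁, h₁⟩ ⟨r₂, hr₂, h₂⟩
      refine ⟨min r₁ r₂, lt_min hr₁ hr₂, ?_⟩
      rintro x (hx | hx) y hy hyx u hu w hw
      · exact h₁ x hx y hy (Metric.ball_subset_ball (min_le_left _ _) hyx) u
          ⟨hu.1, hu.2.trans (min_le_left _ _)⟩ w (hw.trans (min_le_left _ _))
      · exact h₂ x hx y hy (Metric.ball_subset_ball (min_le_right _ _) hyx) u
          ⟨hu.1, hu.2.trans (min_le_right _ _)⟩ w (hw.trans (min_le_right _ _))
    · intro x₀ hx₀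
      obtain ⟨r₀, hr₀, h₀⟩ := hloc x₀ hx₀
      obtain ⟨δ, hδ, hXδ⟩ := Metric.continuousAt_iff.1 hX.continuousAt (r₀ / 2) (half_pos hr₀)
      set r := min δ r₀ / 2 with hr
      have hrpos : 0 < r := half_pos (lt_min hδ hr₀)
      have hrδ : 2 * r ≤ δ := by
        rw [hr]
        linarith [min_le_left δ r₀]
      have hrr₀ : 2 * r ≤ r₀ := by
        rw [hr]
        linarith [min_le_right δ r₀]
      refine ⟨Metric.ball x₀ r, mem_nhdsWithin_of_mem_nhds (Metric.ball_mem_nhds _ hrpos), r,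
        hrpos, fun x hx y hy hyx t ht w hw => ?_⟩
      have hyx₀ : dist y x₀ < 2 * r := by
        have := dist_triangle y x x₀
        rw [Metric.mem_ball] at hx hyx
        linarith
      refine h₀ y hy (hyx₀.trans_le hrr₀) t ⟨ht.1, by linarith [ht.2]⟩ w ?_
      have h1 := hXδ (hyx₀.trans_le hrδ)
      rw [dist_eq_norm] at h1
      have h2 := norm_sub_le_norm_sub_add_norm_sub w (X y) (X x₀)
      linarith
  obtain ⟨r, hr, h⟩ := hunif
  refine ⟨r, hr, fun y hy hyr t ht w hw => ?_⟩
  obtain ⟨z, hz, hyz⟩ := exists_mem_frontier_infDist_compl_eq_dist hy hΩ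
  exact h z hz y hy (by rwa [Metric.mem_ball, ← hyz]) t ht w hw

/-- The distance to the complement of `Ω` grows at a definite rate in all directions close to `X`,
near the boundary of `Ω`. -/
lemma exists_infDist_growth (hΩ : Ω ≠ univ) {X : E → E} {K : NNReal} (hX : LipschitzWith K X)
    (hcone : ∃ r > 0, ∀ y ∈ Ω, Metric.infDist y Ωᶜ < r → ∀ t ∈ Icc 0 r, ∀ w, ‖w - X y‖ ≤ r →
      y + t • w ∈ Ω) :
    ∃ r > 0, ∀ y ∈ closure Ω, Metric.infDist y Ωᶜ < r → ∀ t ∈ Icc 0 r, ∀ w, ‖w - X y‖ ≤ r →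
      Metric.infDist y Ωᶜ + r * t ≤ Metric.infDist (y + t • w) Ωᶜ := by
  obtain ⟨R, hR, h⟩ := hcone
  have hne : Ωᶜ.Nonempty := nonempty_compl.2 hΩ
  have hK : (0 : ℝ) < K + 2 := by positivity
  -- The direction used below differs from the cone axis by at most `r + r + K * r = R`.
  set r := R / (K + 2) with hr
  have hr0 : 0 < r := by positivity
  have hrR : r * (K + 2) = R := div_mul_cancel₀ _ hK.ne'
  have hKr : 0 ≤ K * r := by positivity
  have hint : ∀ y ∈ Ω, Metric.infDist y Ωᶜ < r → ∀ t ∈ Icc 0 r, ∀ w, ‖w - X y‖ ≤ r →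
      Metric.infDist y Ωᶜ + r * t ≤ Metric.infDist (y + t • w) Ωᶜ := by
    intro y hy hyr t ht w hw
    rcases ht.1.eq_or_lt with rfl | ht0
    · simp
    rw [Metric.le_infDist hne]
    -- If some `z ∉ Ω` were too close to `y + t • w`, the error `u` would split proportionally as
    -- `u₁ + t • u₂`. The point `y + u₁` is still in `Ω`, and the cone there contains the direction
    -- `w + u₂`, which leads exactly to `z`.
    intro z hz
    by_contra! hlt
    set b := Metric.infDist y Ωᶜ
    have hb0 : 0 ≤ b := Metric.infDist_nonneg
    have hs : 0 < b + r * t := by positivity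
    set u := z - (y + t • w) with hu
    rw [dist_comm, dist_eq_norm, ← hu] at hlt
    set u₁ := (b / (b + r * t)) • u with hu₁
    set u₂ := (r / (b + r * t)) • u with hu₂
    have hfrac : ‖u‖ / (b + r * t) < 1 := (div_lt_one hs).2 hlt
    have hn1 : ‖u₁‖ ≤ b := by
      rw [hu₁, norm_smul, Real.norm_eq_abs, abs_of_nonneg (by positivity), div_mul_eq_mul_div,
        mul_div_assoc]
      exact mul_le_of_le_one_right hb0 hfrac.le
    have hn2 : ‖u₂‖ ≤ r := by
      rw [hu₂, norm_smul, Real.norm_eq_abs, abs_of_nonneg (by positivity), div_mul_eq_mul_div,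
        mul_div_assoc]
      exact mul_le_of_le_one_right hr0.le hfrac.le
    have hsum : u₁ + t • u₂ = u := by
      rw [hu₁, hu₂, smul_smul, ← add_smul]
      have : b / (b + r * t) + t * (r / (b + r * t)) = 1 := by field_simp
      rw [this, one_smul]
    have hy₁ : y + u₁ ∈ Ω := by
      by_contra hno
      have hb1 : b ≤ dist y (y + u₁) := Metric.infDist_le_dist_of_mem hno
      rw [dist_self_add_right] at hb1
      have hu10 : ‖u₁‖ = b * (‖u‖ / (b + r * t)) := by
        rw [hu₁, norm_smul, Real.norm_eq_abs, abs_of_nonneg (by positivity), div_mul_eq_mul_div,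
          mul_div_assoc]
      rcases hb0.eq_or_lt with hb0' | hb0'
      · have : u₁ = 0 := by rw [hu₁, ← hb0', zero_div, zero_smul]
        rw [this, add_zero] at hno
        exact hno hy
      · have := mul_lt_of_lt_one_right hb0' hfrac
        linarith
    have hb₁ : Metric.infDist (y + u₁) Ωᶜ < R := by
      have := Metric.infDist_le_infDist_add_dist (s := Ωᶜ) (x := y + u₁) (y := y)
      rw [dist_self_add_left] at this
      linarith
    have hXy : ‖X y - X (y + u₁)‖ ≤ K * r := by
      have := hX.dist_le_mul y (y + u₁)
      rw [dist_self_add_right, dist_eq_norm] at this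
      exact this.trans (mul_le_mul_of_nonneg_left (hn1.trans hyr.le) K.coe_nonneg)
    have hdir : ‖w + u₂ - X (y + u₁)‖ ≤ R := by
      calc ‖w + u₂ - X (y + u₁)‖ = ‖(w - X y) + u₂ + (X y - X (y + u₁))‖ := by congr 1; abel
        _ ≤ ‖w - X y‖ + ‖u₂‖ + ‖X y - X (y + u₁)‖ := norm_add₃_le
        _ ≤ R := by linarith
    have := h _ hy₁ hb₁ t ⟨ht.1, by linarith [ht.2]⟩ _ hdir
    refine hz ?_
    convert this using 1
    rw [smul_add, add_assoc, add_left_comm u₁, hsum, ← add_assoc, hu]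
    abel
  -- Halving `r` makes the constraints strict, so that they hold at points of `Ω` near `y` and the
  -- inequality passes to the closure.
  refine ⟨r / 2, half_pos hr0, fun y hy hyr t ht w hw => ?_⟩
  have : (𝓝[Ω] y).NeBot := mem_closure_iff_nhdsWithin_neBot.1 hy
  have hcX := hX.continuous
  have hc1 : Continuous fun z => Metric.infDist (z + t • w) Ωᶜ :=
    (Metric.continuous_infDist_pt _).comp (by fun_prop)
  have hc0 : Continuous fun z => Metric.infDist z Ωᶜ + r * t :=
    (Metric.continuous_infDist_pt _).add continuous_const
  have hc2 : Continuous fun z => ‖w - X z‖ := by fun_prop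
  have hlim : Metric.infDist y Ωᶜ + r * t ≤ Metric.infDist (y + t • w) Ωᶜ := by
    refine le_of_tendsto_of_tendsto (hc0.continuousWithinAt (s := Ω)).tendsto
      (hc1.continuousWithinAt (s := Ω)).tendsto ?_
    have h1 : ∀ᶠ z in 𝓝[Ω] y, Metric.infDist z Ωᶜ < r :=
      ((Metric.continuous_infDist_pt Ωᶜ).continuousAt.eventually_lt_const
        (by linarith)).filter_mono nhdsWithin_le_nhds
    have h2 : ∀ᶠ z in 𝓝[Ω] y, ‖w - X z‖ < r :=
      (hc2.continuousAt.eventually_lt_const (by linarith)).filter_mono nhdsWithin_le_nhds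
    filter_upwards [h1, h2, self_mem_nhdsWithin] with z hz1 hz2 hz
    exact hint z hz hz1 t ⟨ht.1, by linarith [ht.2]⟩ w hz2.le
  have := mul_nonneg hr0.le ht.1
  linarith

end Cone

/-! ### Mollification preserving growth in given directions -/

section Mollify

variable {E : Type*} [NormedAddCommGroup E] [InnerProductSpace ℝ E] [FiniteDimensional ℝ E]

open MeasureTheory in
/-- Smoothing at scale `ε` moves a `1`-Lipschitz function by at most `ε` and keeps lower bounds for
its increments that hold in a ball of radius `ε`. -/
lemma exists_contDiff_approx {b : E → ℝ} (hb : LipschitzWith 1 b) {ε : ℝ} (hε : 0 < ε) :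
    ∃ F : E → ℝ, ContDiff ℝ ∞ F ∧ (∀ y, |F y - b y| ≤ ε) ∧
      ∀ y v c, (∀ z ∈ Metric.ball y ε, b z + c ≤ b (z + v)) → F y + c ≤ F (y + v) := by
  borelize E
  set μ : Measure E := Measure.addHaar
  let ρ : ContDiffBump (0 : E) := ⟨ε / 2, ε, half_pos hε, half_lt_self hε⟩
  have hloc : LocallyIntegrable b μ := hb.continuous.locallyIntegrable
  have hint : ∀ x, Integrable (fun z => ρ.normed μ z * b (x - z)) μ := fun x => by
    have h1 := ρ.continuous_normed (μ := μ)
    have h2 := hb.continuous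
    have h3 : Continuous fun z => ρ.normed μ z * b (x - z) := by fun_prop
    exact h3.integrable_of_hasCompactSupport ρ.hasCompactSupport_normed.mul_right
  -- An increment of the convolution is a weighted average of increments of `b` by the same vector,
  -- from base points in the ball of radius `ε`.
  refine ⟨convolution (ρ.normed μ) b (ContinuousLinearMap.lsmul ℝ ℝ) μ,
    ρ.hasCompactSupport_normed.contDiff_convolution_left _ ρ.contDiff_normed hloc, fun y => ?_,
    fun y v c h => ?_⟩
  · refine ρ.dist_normed_convolution_le hb.continuous.aestronglyMeasurable fun x hx => ?_
    have := hb.dist_le_mul x y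
    rw [NNReal.coe_one, one_mul] at this
    exact this.trans (Metric.mem_ball.1 hx).le
  · have hc : ∫ z, ρ.normed μ z * c ∂μ = c := by
      rw [integral_mul_const, ρ.integral_normed, one_mul]
    have hci : Integrable (fun z => ρ.normed μ z * c) μ := ρ.integrable_normed.mul_const c
    simp only [convolution_def, ContinuousLinearMap.lsmul_apply, smul_eq_mul]
    rw [← hc, ← integral_add (hint y) hci]
    refine integral_mono ((hint y).add hci) (hint (y + v)) fun z => ?_
    by_cases hz : z ∈ Metric.ball (0 : E) ε
    · have h1 := h (y - z) (by simpa using hz)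
      rw [show y - z + v = y + v - z by abel] at h1
      have := mul_le_mul_of_nonneg_left h1 (ρ.nonneg_normed (μ := μ) z)
      simpa [mul_add] using this
    · have : ρ.normed μ z = 0 := by
        rw [← Function.notMem_support, ρ.support_normed_eq]
        exact hz
      simp [this]

end Mollify

/-! ### The collar swept out by the flow, and its integral curves -/

section Collar

variable {E : Type*} [NormedAddCommGroup E] [NormedSpace ℝ E] {Ω : Set E} {X : E → E}
  {φ : ℝ → E → E} {K : NNReal} {δ : ℝ}

/-- The points that the flow `φ` reaches from the boundary of `Ω` in a positive time less
than `δ`. -/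
def flowCollar {E : Type*} [TopologicalSpace E] (φ : ℝ → E → E) (Ω : Set E) (δ : ℝ) :
    Set E :=
  {y | ∃ x ∈ frontier Ω, ∃ s ∈ Ioo 0 δ, φ s x = y}

/-- For times up to `δ` the flow `φ` enters `Ω` through the boundary forward in time, and leaves
its closure backward in time. -/
structure FlowEnters {E : Type*} [TopologicalSpace E] (φ : ℝ → E → E) (Ω : Set E) (δ : ℝ) :
    Prop where
  pos : 0 < δ
  mem : ∀ x ∈ frontier Ω, ∀ s ∈ Ioc 0 δ, φ s x ∈ Ω
  notMem : ∀ x ∈ frontier Ω, ∀ s ∈ Ioc 0 δ, φ (-s) x ∉ closure Ω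

lemma IsFlow.exists_mem_frontier (h : IsFlow X φ) (hΩ : IsOpen Ω) {a b : ℝ} (hab : a ≤ b) {y : E}
    (ha : φ a y ∉ closure Ω) (hb : φ b y ∈ Ω) : ∃ s ∈ Ioo a b, φ s y ∈ frontier Ω := by
  have hpre : IsPreconnected ((fun s => φ s y) '' Icc a b) :=
    isPreconnected_Icc.image _ (h.continuous_time y).continuousOn
  obtain ⟨_, ⟨s, hs, rfl⟩, hsf⟩ : ((fun s => φ s y) '' Icc a b ∩ frontier Ω).Nonempty := by
    by_contra hempty
    have hcov : (fun s => φ s y) '' Icc a b ⊆ Ω ∪ (closure Ω)ᶜ := by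
      intro z hz
      by_contra hz'
      rw [mem_union, not_or, notMem_compl_iff] at hz'
      exact hempty ⟨z, hz, by rw [hΩ.frontier_eq]; exact ⟨hz'.2, hz'.1⟩⟩
    obtain ⟨z, -, hz, hz'⟩ := hpre _ _ hΩ isClosed_closure.isOpen_compl hcov
      ⟨_, mem_image_of_mem _ (right_mem_Icc.2 hab), hb⟩
      ⟨_, mem_image_of_mem _ (left_mem_Icc.2 hab), ha⟩
    exact hz' (subset_closure hz)
  refine ⟨s, ⟨lt_of_le_of_ne hs.1 ?_, lt_of_le_of_ne hs.2 ?_⟩, hsf⟩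
  · rintro rfl
    exact ha (frontier_subset_closure hsf)
  · rintro rfl
    rw [hΩ.frontier_eq] at hsf
    exact hsf.2 hb

lemma IsFlow.mem_flowCollar_of_mem_frontier (h : IsFlow X φ) (hX : LipschitzWith K X) {s : ℝ}
    {y : E} (hs : s ∈ Ioo (-δ) 0) (hy : φ s y ∈ frontier Ω) : y ∈ flowCollar φ Ω δ :=
  ⟨φ s y, hy, -s, ⟨by linarith [hs.2], by linarith [hs.1]⟩, h.neg_apply hX s y⟩

lemma notMem_of_mem_frontier {E : Type*} [TopologicalSpace E] {Ω : Set E} (hΩ : IsOpen Ω) {x : E}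
    (hx : x ∈ frontier Ω) : x ∉ Ω := by
  rw [hΩ.frontier_eq] at hx
  exact hx.2

namespace FlowEnters

lemma collar_subset {E : Type*} [TopologicalSpace E] {Ω : Set E} {φ : ℝ → E → E}
    (h : FlowEnters φ Ω δ) : flowCollar φ Ω δ ⊆ Ω := by
  rintro _ ⟨x, hx, s, hs, rfl⟩
  exact h.mem x hx s ⟨hs.1, hs.2.le⟩

/-- Flowing back from `φ s x` for slightly more or slightly less than `s` ends outside `closure Ω`
or inside `Ω`. Both are open conditions, so nearby orbits also cross the boundary in between. -/
lemma isOpen_collar (h : FlowEnters φ Ω δ) (hφ : IsFlow X φ) (hX : LipschitzWith K X)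
    (hΩ : IsOpen Ω) : IsOpen (flowCollar φ Ω δ) := by
  rw [isOpen_iff_mem_nhds]
  rintro _ ⟨x, hx, s, hs, rfl⟩
  -- With this `η` the crossing times stay in `Ioo (-δ) 0`.
  set η := min s (δ - s) / 2 with hη
  have hm : 0 < min s (δ - s) := lt_min hs.1 (by linarith [hs.2])
  have h1 : η < s := by linarith [min_le_left s (δ - s)]
  have h2 : η < δ - s := by linarith [min_le_right s (δ - s)]
  have hη0 : 0 < η := half_pos hm
  have hc : ∀ a, Continuous (φ a) := fun a => by
    have := hφ.continuous hX
    exact this.comp (by fun_prop : Continuous fun y : E => (a, y))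
  have e1 : ∀ᶠ y in 𝓝 (φ s x), φ (-s - η) y ∈ (closure Ω)ᶜ := by
    refine (hc _).continuousAt.eventually_mem (isClosed_closure.isOpen_compl.mem_nhds ?_)
    rw [← hφ.add hX, show -s - η + s = -η by ring]
    exact h.notMem x hx η ⟨hη0, by linarith [hs.1]⟩
  have e2 : ∀ᶠ y in 𝓝 (φ s x), φ (-s + η) y ∈ Ω := by
    refine (hc _).continuousAt.eventually_mem (hΩ.mem_nhds ?_)
    rw [← hφ.add hX, show -s + η + s = η by ring]
    exact h.mem x hx η ⟨hη0, by linarith [hs.1]⟩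
  filter_upwards [e1, e2] with y h3 h4
  obtain ⟨a, ha, hya⟩ := hφ.exists_mem_frontier hΩ (by linarith) h3 h4
  exact hφ.mem_flowCollar_of_mem_frontier hX ⟨by linarith [ha.1], by linarith [ha.2]⟩ hya

lemma collar_mem_nhdsWithin (h : FlowEnters φ Ω δ) (hφ : IsFlow X φ) (hX : LipschitzWith K X)
    (hΩ : IsOpen Ω) {x : E} (hx : x ∈ frontier Ω) : flowCollar φ Ω δ ∈ 𝓝[Ω] x := by
  have hc : Continuous (φ (-δ)) := by
    have := hφ.continuous hX
    exact this.comp (by fun_prop : Continuous fun y : E => (-δ, y))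
  have e1 : ∀ᶠ y in 𝓝 x, φ (-δ) y ∈ (closure Ω)ᶜ :=
    hc.continuousAt.eventually_mem (isClosed_closure.isOpen_compl.mem_nhds
      (h.notMem x hx δ ⟨h.pos, le_rfl⟩))
  filter_upwards [nhdsWithin_le_nhds e1, self_mem_nhdsWithin] with y h1 hy
  obtain ⟨a, ha, hya⟩ := hφ.exists_mem_frontier hΩ (neg_nonpos.2 h.pos.le) h1
    (by rwa [hφ.zero])
  exact hφ.mem_flowCollar_of_mem_frontier hX ha hya

/-- With unequal times, one boundary point would be the image of the other after a positive time at
most `δ`, hence lie in `Ω`. The closed time interval matters: it gives a compact domain for the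
homeomorphism and excludes the end time `δ` from the collar. -/
lemma eq_of_flow_eq (h : FlowEnters φ Ω δ) (hφ : IsFlow X φ) (hX : LipschitzWith K X)
    (hΩ : IsOpen Ω) {x x' : E} (hx : x ∈ frontier Ω) (hx' : x' ∈ frontier Ω) {s s' : ℝ}
    (hs : s ∈ Icc 0 δ) (hs' : s' ∈ Icc 0 δ) (heq : φ s x = φ s' x') : s = s' ∧ x = x' := by
  have key : ∀ x ∈ frontier Ω, ∀ x' ∈ frontier Ω, ∀ s ∈ Icc 0 δ, ∀ s' ∈ Icc 0 δ,
      φ s x = φ s' x' → s' ≤ s := by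
    intro x hx x' hx' s hs s' hs' heq
    by_contra! hlt
    have h1 : φ (s' - s) x' = x := by
      rw [sub_eq_neg_add, hφ.add hX, ← heq, hφ.neg_apply hX]
    refine notMem_of_mem_frontier hΩ hx (h1 ▸ h.mem x' hx' (s' - s) ⟨by linarith, ?_⟩)
    linarith [hs.1, hs'.2]
  have hss : s = s' := le_antisymm (key x' hx' x hx s' hs' s hs heq.symm)
    (key x hx x' hx' s hs s' hs' heq)
  refine ⟨hss, ?_⟩
  rw [← hφ.neg_apply hX s x, heq, hss, hφ.neg_apply hX]

/-- On the compact product with `Icc 0 1` the continuous injection `(x, t) ↦ φ (δ * t) x` is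
automatically an embedding; it is then restricted to `Ico 0 1`. -/
lemma exists_homeomorph (h : FlowEnters φ Ω δ) (hφ : IsFlow X φ) (hX : LipschitzWith K X)
    (hΩ : IsOpen Ω) (hcomp : IsCompact (frontier Ω)) :
    ∃ g : (frontier Ω × Ico (0 : ℝ) 1) ≃ₜ (frontier Ω ∪ flowCollar φ Ω δ : Set E),
      ∀ x : frontier Ω, (g (x, ⟨0, by norm_num⟩) : E) = x := by
  have : CompactSpace (frontier Ω) := isCompact_iff_compactSpace.1 hcomp
  have hcφ := hφ.continuous hX
  let f : frontier Ω × Icc (0 : ℝ) 1 → E := fun p => φ (δ * p.2) p.1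
  have hf : Continuous f := hcφ.comp
    (by fun_prop : Continuous fun p : frontier Ω × Icc (0 : ℝ) 1 => (δ * (p.2 : ℝ), (p.1 : E)))
  have hmul : ∀ t ∈ Icc (0 : ℝ) 1, δ * t ∈ Icc 0 δ := fun t ht =>
    ⟨mul_nonneg h.pos.le ht.1, mul_le_of_le_one_right h.pos.le ht.2⟩
  have hinj : Function.Injective f := by
    rintro ⟨x, t⟩ ⟨x', t'⟩ heq
    obtain ⟨h1, h2⟩ := h.eq_of_flow_eq hφ hX hΩ x.2 x'.2 (hmul t t.2) (hmul t' t'.2) heq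
    exact Prod.ext (Subtype.ext h2) (Subtype.ext (mul_left_cancel₀ h.pos.ne' h1))
  let ι : frontier Ω × Ico (0 : ℝ) 1 → frontier Ω × Icc (0 : ℝ) 1 :=
    Prod.map id (inclusion Ico_subset_Icc_self)
  have hι : IsEmbedding ι := IsEmbedding.id.prodMap (IsEmbedding.inclusion _)
  have hfe : IsEmbedding f := (hf.isClosedEmbedding hinj).isEmbedding
  have hemb := hfe.comp hι
  have hrange : range (f ∘ ι) = frontier Ω ∪ flowCollar φ Ω δ := by
    ext y
    constructor
    · rintro ⟨⟨x, t⟩, rfl⟩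
      rcases t.2.1.eq_or_lt with h0 | h0
      · left
        have : φ (δ * (t : ℝ)) x = x := by rw [← h0, mul_zero, hφ.zero]
        change φ (δ * (t : ℝ)) x ∈ frontier Ω
        rw [this]
        exact x.2
      · exact Or.inr ⟨x, x.2, δ * t, ⟨mul_pos h.pos h0, mul_lt_of_lt_one_right h.pos t.2.2⟩, rfl⟩
    · rintro (hy | ⟨x, hx, s, hs, rfl⟩)
      · refine ⟨(⟨y, hy⟩, ⟨0, by norm_num⟩), ?_⟩
        simp [f, ι, hφ.zero]
      · refine ⟨(⟨x, hx⟩, ⟨s / δ, div_nonneg hs.1.le h.pos.le, (div_lt_one h.pos).2 hs.2⟩), ?_⟩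
        simp [f, ι, mul_div_cancel₀ _ h.pos.ne']
  refine ⟨hemb.toHomeomorph.trans (Homeomorph.setCongr hrange), fun x => ?_⟩
  change φ (δ * 0) (x : E) = x
  rw [mul_zero, hφ.zero]

/-- The maximal integral curves of `-X` in the collar are the full flow lines. -/
lemma eq_of_isMaximalIntegralCurveIn {E : Type*} [NormedAddCommGroup E] [InnerProductSpace ℝ E]
    {Ω : Set E} {X : E → E} {φ : ℝ → E → E} (h : FlowEnters φ Ω δ) (hφ : IsFlow X φ)
    (hX : LipschitzWith K X) (hΩ : IsOpen Ω) {Γ : E → E} (hΓ : ∀ y ∈ Ω, X y = -Γ y) {γ : ℝ → E}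
    {J : Set ℝ} (hγ : IsMaximalIntegralCurveIn Γ (flowCollar φ Ω δ) γ J) :
    ∃ x ∈ frontier Ω, ∃ c, J = Ioo (c - δ) c ∧ ∀ t ∈ J, γ t = φ (c - t) x := by
  obtain ⟨t₀, ht₀⟩ := hγ.nonempty
  obtain ⟨x, hx, s, hs, hxs⟩ := hγ.mapsTo ht₀
  set c := s + t₀ with hc
  have hder : ∀ t ∈ J, HasDerivAt γ (-X (γ t)) t := by
    intro t ht
    rw [hΓ _ (h.collar_subset (hγ.mapsTo ht)), neg_neg]
    exact (hγ.isIntegralCurveOn t ht).hasDerivAt (hγ.isOpen.mem_nhds ht)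
  have hflow : ∀ t ∈ J, γ t = φ (c - t) x := by
    intro t ht
    obtain ⟨ε₁, hε₁, h₁⟩ := Metric.isOpen_iff.1 hγ.isOpen (min t t₀)
      (by rcases min_choice t t₀ with h | h <;> rw [h] <;> assumption)
    obtain ⟨ε₂, hε₂, h₂⟩ := Metric.isOpen_iff.1 hγ.isOpen (max t t₀)
      (by rcases max_choice t t₀ with h | h <;> rw [h] <;> assumption)
    have ha : min t t₀ - ε₁ / 2 ∈ J := h₁ (by simp [abs_of_pos hε₁, hε₁])
    have hb : max t t₀ + ε₂ / 2 ∈ J := h₂ (by simp [abs_of_pos hε₂, hε₂])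
    have hsub : Ioo (min t t₀ - ε₁ / 2) (max t t₀ + ε₂ / 2) ⊆ J :=
      Ioo_subset_Icc_self.trans (hγ.ordConnected.out ha hb)
    have := hφ.reverse.eqOn_Ioo (K := K) hX.neg (γ := γ) (a := min t t₀ - ε₁ / 2)
      (b := max t t₀ + ε₂ / 2) (t₀ := t₀)
      ⟨by linarith [min_le_right t t₀], by linarith [le_max_right t t₀]⟩
      (fun r hr => hder r (hsub hr)) t
      ⟨by linarith [min_le_left t t₀], by linarith [le_max_left t t₀]⟩
    rw [this, ← hxs, ← hφ.add hX, hc]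
    congr 1
    ring
  have hJ : J ⊆ Ioo (c - δ) c := by
    intro t ht
    constructor
    · by_contra! hle
      -- At this time the curve would be at `φ δ x`, which is not in the collar by injectivity up to
      -- time `δ`.
      have hmem : c - δ ∈ J := hγ.ordConnected.out ht ht₀ ⟨hle, by linarith [hs.2]⟩
      obtain ⟨x', hx', s', hs', heq⟩ := hγ.mapsTo hmem
      rw [hflow _ hmem, sub_sub_cancel] at heq
      have := (h.eq_of_flow_eq hφ hX hΩ hx' hx ⟨hs'.1.le, hs'.2.le⟩ ⟨h.pos.le, le_rfl⟩ heq).1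
      exact hs'.2.ne this
    · by_contra! hle
      have hmem : c ∈ J := hγ.ordConnected.out ht₀ ht ⟨by linarith [hs.1], hle⟩
      have := h.collar_subset (hγ.mapsTo hmem)
      rw [hflow _ hmem, sub_self, hφ.zero] at this
      exact notMem_of_mem_frontier hΩ hx this
  refine ⟨x, hx, c, ?_, hflow⟩
  have hmaps : MapsTo (fun t => φ (c - t) x) (Ioo (c - δ) c) (flowCollar φ Ω δ) := fun t ht =>
    ⟨x, hx, c - t, ⟨by linarith [ht.2], by linarith [ht.1]⟩, rfl⟩
  refine (hγ.maximal (fun t => φ (c - t) x) (Ioo (c - δ) c) isOpen_Ioo ordConnected_Ioo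
    (fun t ht => ?_) hmaps hJ hflow).symm
  have h1 := ((hφ.hasDerivAt x (c - t)).scomp t ((hasDerivAt_id t).const_sub c)).hasDerivWithinAt
    (s := Ioo (c - δ) c)
  rw [hΓ _ (h.collar_subset (hmaps ht))] at h1
  simpa [Function.comp_def] using h1

end FlowEnters

end Collar

/-! ### The smooth level function and the hypersurface -/

variable {E : Type*} [NormedAddCommGroup E] [InnerProductSpace ℝ E]

lemma IsTransversalField.congr {Ω : Set E} {Γ Γ' : E → E} (hΓ : IsTransversalField Ω Γ)
    (hΓ' : ContDiff ℝ ∞ Γ') (heq : EqOn Γ' Γ (frontier Ω)) : IsTransversalField Ω Γ' := by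
  obtain ⟨θ, hθ, h⟩ := hΓ.transversal
  exact ⟨hΓ', θ, hθ, fun x ν hν => by simpa only [heq hν.mem_frontier] using h x ν hν⟩

/-- A smooth vector field agrees on a bounded set with a bounded Lipschitz one. -/
lemma exists_contDiff_lipschitz_eqOn [FiniteDimensional ℝ E] {s : Set E}
    (hs : Bornology.IsBounded s) {Γ : E → E} (hΓ : ContDiff ℝ ∞ Γ) :
    ∃ (Γ' : E → E) (K M : NNReal), ContDiff ℝ ∞ Γ' ∧ LipschitzWith K Γ' ∧ (∀ x, ‖Γ' x‖ ≤ M) ∧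
      EqOn Γ' Γ s := by
  obtain ⟨R, hR0, hR⟩ := hs.subset_closedBall_lt 0 (0 : E)
  let f : ContDiffBump (0 : E) := ⟨R, R + 1, hR0, by linarith⟩
  have hsm : ContDiff ℝ ∞ fun x => f x • Γ x := f.contDiff.smul hΓ
  have hcs : HasCompactSupport fun x => f x • Γ x := f.hasCompactSupport.smul_right
  obtain ⟨K, hK⟩ := hsm.lipschitzWith_of_hasCompactSupport hcs (by simp)
  obtain ⟨M, hM⟩ := hcs.exists_bound_of_continuous hsm.continuous
  refine ⟨fun x => f x • Γ x, K, M.toNNReal, hsm, hK,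
    fun x => (hM x).trans (Real.le_coe_toNNReal M), fun x hx => ?_⟩
  change f x • Γ x = Γ x
  rw [f.one_of_mem_closedBall (hR hx), one_smul]

lemma infDist_compl_eq_zero {E : Type*} [PseudoMetricSpace E] {Ω : Set E} (hΩ : IsOpen Ω) {x : E}
    (hx : x ∈ frontier Ω) : Metric.infDist x Ωᶜ = 0 :=
  Metric.infDist_zero_of_mem (notMem_of_mem_frontier hΩ hx)

/-- Along the flow of `X` the distance to the complement of `Ω` grows at a definite rate, if it
does so in all directions close to `X`. -/
lemma IsFlow.infDist_growth {Ω : Set E} {X : E → E} {φ : ℝ → E → E} {K : NNReal} {M r δ : ℝ}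
    (hφ : IsFlow X φ) (hX : LipschitzWith K X) (hM : ∀ x, ‖X x‖ ≤ M)
    (hr : ∀ y ∈ closure Ω, Metric.infDist y Ωᶜ < r → ∀ t ∈ Icc 0 r, ∀ w, ‖w - X y‖ ≤ r →
      Metric.infDist y Ωᶜ + r * t ≤ Metric.infDist (y + t • w) Ωᶜ)
    (hδr : δ ≤ r) (hKδ : K * M * δ ≤ r) {y : E} (hy : y ∈ closure Ω)
    (hyr : Metric.infDist y Ωᶜ < r) {s : ℝ} (hs : s ∈ Icc 0 δ) :
    Metric.infDist y Ωᶜ + r * s ≤ Metric.infDist (φ s y) Ωᶜ := by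
  rcases hs.1.eq_or_lt with rfl | hs0
  · simp [hφ.zero]
  obtain ⟨w, hw, hwX⟩ := hφ.exists_eq_add_smul hX hM hs0 y
  rw [hw]
  have hM0 : 0 ≤ M := (norm_nonneg _).trans (hM y)
  refine hr y hy hyr s ⟨hs.1, hs.2.trans hδr⟩ w (hwX.trans (le_trans ?_ hKδ))
  have : 0 ≤ K * M := by positivity
  exact mul_le_mul_of_nonneg_left hs.2 this

/-- Forward, the distance becomes positive. Backward, a point of `closure Ω` would flow to a
boundary point with positive distance; `M * δ < r` keeps it in the zone where growth is known. -/
lemma flowEnters_of_infDist_growth {Ω : Set E} (hΩ : IsOpen Ω) {X : E → E} {φ : ℝ → E → E}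
    {M r δ : ℝ} (hφ : IsFlow X φ) (hM : ∀ x, ‖X x‖ ≤ M) (hr : 0 < r) (hδ : 0 < δ) (hMδ : M * δ < r)
    (hgrow : ∀ y ∈ closure Ω, Metric.infDist y Ωᶜ < r → ∀ s ∈ Icc 0 δ,
      Metric.infDist y Ωᶜ + r * s ≤ Metric.infDist (φ s y) Ωᶜ)
    {K : NNReal} (hX : LipschitzWith K X) : FlowEnters φ Ω δ where
  pos := hδ
  mem x hx s hs := by
    by_contra hno
    have h0 := infDist_compl_eq_zero hΩ hx
    have := hgrow x (frontier_subset_closure hx) (by rwa [h0]) s ⟨hs.1.le, hs.2⟩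
    rw [h0, Metric.infDist_zero_of_mem hno, zero_add] at this
    exact (mul_pos hr hs.1).not_ge this
  notMem x hx s hs hmem := by
    have hM0 : 0 ≤ M := (norm_nonneg _).trans (hM x)
    have h1 : Metric.infDist (φ (-s) x) Ωᶜ < r := by
      refine (Metric.infDist_le_dist_of_mem (notMem_of_mem_frontier hΩ hx)).trans_lt ?_
      have := hφ.norm_sub_le hM (-s) 0 x
      rw [hφ.zero, sub_zero, abs_neg, abs_of_pos hs.1, ← dist_eq_norm] at this
      exact this.trans_lt ((mul_le_mul_of_nonneg_left hs.2 hM0).trans_lt hMδ)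
    have h2 := hgrow _ hmem h1 s ⟨hs.1.le, hs.2⟩
    rw [hφ.apply_neg hX, infDist_compl_eq_zero hΩ hx] at h2
    have h3 := mul_pos hr hs.1
    have h4 : 0 ≤ Metric.infDist (φ (-s) x) Ωᶜ := Metric.infDist_nonneg
    linarith

/-- A smooth approximation of the distance to the complement of `Ω` that grows at a definite rate
in all directions close to `X`, at a definite distance from the boundary. -/
lemma exists_contDiff_growth [FiniteDimensional ℝ E] {Ω : Set E} {X : E → E} {K : NNReal} {r : ℝ}
    (hX : LipschitzWith K X)
    (hgrow : ∀ y ∈ closure Ω, Metric.infDist y Ωᶜ < r → ∀ t ∈ Icc 0 r, ∀ w, ‖w - X y‖ ≤ r →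
      Metric.infDist y Ωᶜ + r * t ≤ Metric.infDist (y + t • w) Ωᶜ) {ε : ℝ} (hε : 0 < ε)
    (hKε : K * ε ≤ r / 2) :
    ∃ F : E → ℝ, ContDiff ℝ ∞ F ∧ (∀ y, |F y - Metric.infDist y Ωᶜ| ≤ ε) ∧
      ∀ y, ε < Metric.infDist y Ωᶜ → Metric.infDist y Ωᶜ < r / 2 → ∀ t ∈ Icc 0 r, ∀ w,
        ‖w - X y‖ ≤ r / 2 → F y + r * t ≤ F (y + t • w) := by
  obtain ⟨F, hF, hFb, hFg⟩ := exists_contDiff_approx (Metric.lipschitz_infDist_pt Ωᶜ) hε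
  -- As `y` is farther than `ε` from the complement, the averaging ball stays in `Ω`; over it `X`
  -- varies by at most `K * ε ≤ r / 2`, so `w` is admissible at each of its points.
  refine ⟨F, hF, hFb, fun y hy hyr t ht w hw => hFg y _ _ fun z hz => ?_⟩
  have hz' : dist z y < ε := hz
  have h1 := Metric.infDist_le_infDist_add_dist (s := Ωᶜ) (x := y) (y := z)
  have h2 := Metric.infDist_le_infDist_add_dist (s := Ωᶜ) (x := z) (y := y)
  rw [dist_comm] at h1
  have hzΩ : z ∈ Ω := by
    by_contra hno
    have h0 : Metric.infDist z Ωᶜ = 0 := Metric.infDist_zero_of_mem hno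
    linarith
  refine hgrow z (subset_closure hzΩ) (by linarith) t ht w ?_
  have h3 := hX.dist_le_mul y z
  rw [dist_eq_norm, dist_comm] at h3
  have h4 := mul_le_mul_of_nonneg_left hz'.le K.coe_nonneg
  have h5 := norm_sub_le_norm_sub_add_norm_sub w (X y) (X z)
  linarith

lemma le_fderiv_of_growth {F : E → ℝ} {y v : E} {r a : ℝ} (hF : DifferentiableAt ℝ F y)
    (ha : 0 < a) (h : ∀ t ∈ Icc 0 a, F y + r * t ≤ F (y + t • v)) : r ≤ fderiv ℝ F y v := by
  have h1 : HasDerivAt (fun t : ℝ => y + t • v) v 0 := by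
    simpa using ((hasDerivAt_id (0 : ℝ)).smul_const v).const_add y
  have h2 : HasFDerivAt F (fderiv ℝ F y) (y + (0 : ℝ) • v) := by simpa using hF.hasFDerivAt
  have h3 : HasDerivAt (fun t : ℝ => F (y + t • v)) (fderiv ℝ F y v) 0 := h2.comp_hasDerivAt 0 h1
  have h4 := (hasDerivAt_iff_tendsto_slope.1 h3).mono_left
    (nhdsWithin_mono 0 fun s (hs : s ∈ Ioi (0 : ℝ)) => ne_of_gt hs)
  refine ge_of_tendsto h4 ?_
  filter_upwards [Ioc_mem_nhdsGT ha] with t ht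
  rw [slope_def_field, le_div_iff₀ (by linarith [ht.1])]
  have := h t ⟨ht.1.le, ht.2⟩
  simp only [zero_smul, add_zero, sub_zero]
  linarith

lemma fderiv_apply_eq_zero_of_mem_tangentVectors {S : Set E} {F : E → ℝ} {a : ℝ} {p v : E}
    (hF : DifferentiableAt ℝ F p) (hS : ∀ y ∈ S, F y = a) (hv : v ∈ tangentVectors S p) :
    fderiv ℝ F p v = 0 := by
  obtain ⟨c, hc0, hcS, hcd⟩ := hv
  have h1 : HasFDerivAt F (fderiv ℝ F p) (c 0) := by
    rw [hc0]
    exact hF.hasFDerivAt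
  have h2 : HasDerivAt (fun t => F (c t)) (fderiv ℝ F p v) 0 := h1.comp_hasDerivAt 0 hcd
  have h3 : (fun t => F (c t)) =ᶠ[𝓝 0] fun _ => a := hcS.mono fun t ht => hS _ ht
  exact h2.unique ((hasDerivAt_const (0 : ℝ) a).congr_of_eventuallyEq h3)

/-- An interior collar of the boundary of a bounded Lipschitz domain, and a compact smooth
hypersurface in it that is crossed by each flow line of a transversal field. -/
theorem IsBoundedLipschitzDomain.exists_collar_hypersurface [FiniteDimensional ℝ E] [Nontrivial E]
    {Ω : Set E} (hΩ : IsBoundedLipschitzDomain Ω) {Γ : E → E} (hΓ : IsTransversalField Ω Γ) :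
    ∃ U S : Set E, IsInteriorCollar Ω U ∧ S ⊆ U ∧ IsCompact S ∧ IsSmoothHypersurface S ∧
      (∀ (γ : ℝ → E) (J : Set ℝ), IsMaximalIntegralCurveIn Γ U γ J → ∃! t : ℝ, t ∈ J ∧ γ t ∈ S) ∧
      (∀ p ∈ S, Γ p ∉ tangentVectors S p) := by
  have hopen := hΩ.isOpen
  have huniv : Ω ≠ univ := fun h => NormedSpace.unbounded_univ ℝ E (h ▸ hΩ.isBounded)
  obtain ⟨Γ', K, M, hsm, hK, hM, heq⟩ :=
    exists_contDiff_lipschitz_eqOn hΩ.isBounded.closure hΓ.smooth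
  have hΓ' := hΓ.congr hsm (heq.mono frontier_subset_closure)
  obtain ⟨c₀, hc₀, htr⟩ := hΓ'.exists_le_inner
  set X : E → E := fun x => -Γ' x with hXdef
  have hX : LipschitzWith K X := hK.neg
  have hXM : ∀ x, ‖X x‖ ≤ M := fun x => by simpa [hXdef] using hM x
  have hXΓ : ∀ y ∈ Ω, X y = -Γ y := fun y hy => by rw [hXdef, ← heq (subset_closure hy)]
  obtain ⟨r, hr, hgrow⟩ := exists_infDist_growth huniv hX
    (exists_uniform_cone hΩ.isBounded huniv hX.continuous
      fun x hx => exists_local_cone hopen hΩ.lipschitz hsm.continuous hc₀ htr hx)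
  obtain ⟨φ, hφ⟩ := exists_isFlow hX hXM
  have hcφ := hφ.continuous hX
  -- `δ ≤ 1 / 2` keeps the level set within distance `r / 2` of the complement; the last bound keeps
  -- mean flow velocities up to time `δ` within `r / 2` of `X`, as the growth of `F` requires.
  obtain ⟨δ, hδ, hδr, hδ1, hMδ, hKδ⟩ : ∃ δ > 0, δ ≤ r ∧ δ ≤ 1 / 2 ∧ M * δ < r ∧
      K * M * δ ≤ r / 2 := by
    refine ⟨min (min r (1 / 2)) (min (r / (M + 1)) (r / 2 / (K * M + 1))), by positivity,
      (min_le_left _ _).trans (min_le_left _ _), (min_le_left _ _).trans (min_le_right _ _), ?_, ?_⟩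
    · have h1 : min (min r (1 / 2)) (min (r / (M + 1)) (r / 2 / (K * M + 1))) ≤ r / (M + 1) :=
        (min_le_right _ _).trans (min_le_left _ _)
      refine (mul_le_mul_of_nonneg_left h1 M.coe_nonneg).trans_lt ?_
      rw [mul_div_assoc', div_lt_iff₀ (by positivity)]
      linarith
    · have h1 : min (min r (1 / 2)) (min (r / (M + 1)) (r / 2 / (K * M + 1))) ≤
          r / 2 / (K * M + 1) := (min_le_right _ _).trans (min_le_right _ _)
      refine (mul_le_mul_of_nonneg_left h1 (by positivity)).trans ?_
      rw [mul_div_assoc', div_le_iff₀ (by positivity)]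
      linarith
  have hflow : ∀ y ∈ closure Ω, Metric.infDist y Ωᶜ < r → ∀ s ∈ Icc 0 δ,
      Metric.infDist y Ωᶜ + r * s ≤ Metric.infDist (φ s y) Ωᶜ := fun y hy hyr s hs =>
    hφ.infDist_growth hX hXM hgrow hδr (by linarith) hy hyr hs
  have hent : FlowEnters φ Ω δ :=
    flowEnters_of_infDist_growth hopen hφ hXM hr hδ hMδ hflow hX
  have hcomp : IsCompact (frontier Ω) :=
    Metric.isCompact_of_isClosed_isBounded isClosed_frontier
      (hΩ.isBounded.closure.subset frontier_subset_closure)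
  -- The level lies halfway between the distance `0` at the boundary and the lower bound `r * δ`
  -- after time `δ`; `4 * ε ≤ a` leaves room for the smoothing error.
  set a := r * δ / 2 with ha
  have hrδ : 0 < r * δ := mul_pos hr hδ
  obtain ⟨ε, hε, hKε, hεa⟩ : ∃ ε > 0, K * ε ≤ r / 2 ∧ 4 * ε ≤ a := by
    refine ⟨min (r / 2 / (K + 1)) (a / 4), by positivity, ?_, ?_⟩
    · refine (mul_le_mul_of_nonneg_left (min_le_left _ _) K.coe_nonneg).trans ?_
      rw [mul_div_assoc', div_le_iff₀ (by positivity)]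
      linarith
    · linarith [min_le_right (r / 2 / (K + 1)) (a / 4)]
  obtain ⟨F, hF, hFb, hFg⟩ := exists_contDiff_growth hX hgrow hε hKε
  have hFlow : ∀ y, F y - ε ≤ Metric.infDist y Ωᶜ := fun y => by
    linarith [(abs_le.1 (hFb y)).2]
  have hFup : ∀ y, Metric.infDist y Ωᶜ ≤ F y + ε := fun y => by
    linarith [(abs_le.1 (hFb y)).1]
  have hlevel : ∀ y, F y = a → ε < Metric.infDist y Ωᶜ ∧ Metric.infDist y Ωᶜ < r / 2 := by
    intro y hy
    have h1 := hFlow y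
    have h2 := hFup y
    rw [hy] at h1 h2
    refine ⟨by linarith, h2.trans_lt ?_⟩
    have : r * δ ≤ r * (1 / 2) := mul_le_mul_of_nonneg_left hδ1 hr.le
    linarith
  have hF0 : ∀ x ∈ frontier Ω, F (φ 0 x) < a := by
    intro x hx
    have h1 := hFlow x
    rw [infDist_compl_eq_zero hopen hx] at h1
    rw [hφ.zero]
    linarith
  have hFδ : ∀ x ∈ frontier Ω, a < F (φ δ x) := by
    intro x hx
    have h0 := infDist_compl_eq_zero hopen hx
    have h1 := hFup (φ δ x)
    have h2 := hflow x (frontier_subset_closure hx) (by rwa [h0]) δ ⟨hδ.le, le_rfl⟩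
    linarith
  have hcF : Continuous F := hF.continuous
  have hdF : Differentiable ℝ F := hF.differentiable (by simp)
  have hFX : ∀ p, F p = a → 0 < fderiv ℝ F p (X p) := fun p hp =>
    hr.trans_le (le_fderiv_of_growth (hdF p) hr fun t ht =>
      hFg p (hlevel p hp).1 (hlevel p hp).2 t ht _ (by rw [sub_self, norm_zero]; positivity))
  -- Growth of `F` is known only away from the boundary, so monotonicity along whole flow lines is
  -- not available. Staying above `a` after any crossing suffices for uniqueness.
  have hmono : ∀ y, F y = a → ∀ s ∈ Ioc 0 δ, a < F (φ s y) := by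
    intro y hy s hs
    obtain ⟨w, hw, hwX⟩ := hφ.exists_eq_add_smul hX hXM hs.1 y
    have h1 := hFg y (hlevel y hy).1 (hlevel y hy).2 s ⟨hs.1.le, hs.2.trans hδr⟩ w
      (hwX.trans ((mul_le_mul_of_nonneg_left hs.2 (by positivity)).trans hKδ))
    rw [hw]
    linarith [mul_pos hr hs.1]
  have huniq : ∀ x s s', s ∈ Ioo 0 δ → s' ∈ Ioo 0 δ → F (φ s x) = a → F (φ s' x) = a → s' ≤ s := by
    intro x s s' hs hs' h1 h2
    by_contra! hlt
    have h3 := hmono _ h1 (s' - s) ⟨by linarith, by linarith [hs.1, hs'.2]⟩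
    rw [← hφ.add hX, sub_add_cancel, h2] at h3
    exact lt_irrefl _ h3
  refine ⟨flowCollar φ Ω δ, {y | y ∈ flowCollar φ Ω δ ∧ F y = a},
    ⟨hent.isOpen_collar hφ hX hopen, hent.collar_subset,
      fun x hx => hent.collar_mem_nhdsWithin hφ hX hopen hx,
      hent.exists_homeomorph hφ hX hopen hcomp⟩, fun y hy => hy.1, ?_, ?_, ?_, ?_⟩
  · have hc : Continuous fun p : E × ℝ => φ p.2 p.1 := hcφ.comp continuous_swap
    -- Closing the time interval adds no points: `F` is below `a` at time `0` and above `a` at time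
    -- `δ`.
    have hT : IsCompact ((frontier Ω ×ˢ Icc 0 δ) ∩ {p : E × ℝ | F (φ p.2 p.1) = a}) :=
      (hcomp.prod isCompact_Icc).inter_right (isClosed_eq (hcF.comp hc) continuous_const)
    convert hT.image hc using 1
    ext y
    constructor
    · rintro ⟨⟨x, hx, s, hs, rfl⟩, hy⟩
      exact ⟨(x, s), ⟨⟨hx, Ioo_subset_Icc_self hs⟩, hy⟩, rfl⟩
    · rintro ⟨⟨x, s⟩, ⟨⟨hx, hs⟩, hy⟩, rfl⟩
      refine ⟨⟨x, hx, s, ⟨lt_of_le_of_ne hs.1 ?_, lt_of_le_of_ne hs.2 ?_⟩, rfl⟩, hy⟩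
      · rintro rfl
        exact (hF0 x hx).ne hy
      · rintro rfl
        exact (hFδ x hx).ne' hy
  · rintro p ⟨hpU, hp⟩
    refine ⟨flowCollar φ Ω δ, fun y => F y - a, hent.isOpen_collar hφ hX hopen, hpU,
      (hF.sub contDiff_const).contDiffOn, fun h0 => ?_, fun y hy => ?_⟩
    · rw [fderiv_sub_const] at h0
      have := hFX p hp
      rw [h0] at this
      exact lt_irrefl _ this
    · rw [sub_eq_zero]
      exact ⟨fun h => h.2, fun h => ⟨hy, h⟩⟩
  · intro γ J hγ
    obtain ⟨x, hx, c, rfl, hγx⟩ := hent.eq_of_isMaximalIntegralCurveIn hφ hX hopen hXΓ hγ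
    obtain ⟨s, hs, hsF⟩ : a ∈ (fun s => F (φ s x)) '' Ioo 0 δ :=
      intermediate_value_Ioo hδ.le (hcF.comp (hφ.continuous_time x)).continuousOn
        ⟨hF0 x hx, hFδ x hx⟩
    have hcs : c - s ∈ Ioo (c - δ) c := ⟨by linarith [hs.2], by linarith [hs.1]⟩
    refine ⟨c - s, ⟨hcs, hγ.mapsTo hcs, ?_⟩, ?_⟩
    · rw [hγx _ hcs, sub_sub_cancel]
      exact hsF
    · rintro t ⟨ht, -, htF⟩
      rw [hγx t ht] at htF
      have hct : c - t ∈ Ioo 0 δ := ⟨by linarith [ht.2], by linarith [ht.1]⟩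
      have h1 := huniq x s (c - t) hs hct hsF htF
      have h2 := huniq x (c - t) s hct hs htF hsF
      linarith
  · rintro p ⟨hpU, hp⟩ hmem
    have h0 := fderiv_apply_eq_zero_of_mem_tangentVectors (hdF p) (fun y hy => hy.2) hmem
    have h1 := hFX p hp
    rw [hXΓ p (hent.collar_subset hpU), map_neg, h0, neg_zero] at h1
    exact lt_irrefl _ h1

end LipschitzSurface

theorem lemma3p1 (d : ℕ) (Ω : Set (EuclideanSpace ℝ (Fin (d + 1))))
    (hΩ : LipschitzSurface.IsBoundedLipschitzDomain Ω)
    (Γ : EuclideanSpace ℝ (Fin (d + 1)) → EuclideanSpace ℝ (Fin (d + 1)))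
    (hΓ : LipschitzSurface.IsTransversalField Ω Γ) :
    ∃ U S : Set (EuclideanSpace ℝ (Fin (d + 1))),
      LipschitzSurface.IsInteriorCollar Ω U ∧
      S ⊆ U ∧ IsCompact S ∧ LipschitzSurface.IsSmoothHypersurface S ∧
      (∀ (γ : ℝ → EuclideanSpace ℝ (Fin (d + 1))) (J : Set ℝ),
        LipschitzSurface.IsMaximalIntegralCurveIn Γ U γ J → ∃! t : ℝ, t ∈ J ∧ γ t ∈ S) ∧
      (∀ p ∈ S, Γ p ∉ LipschitzSurface.tangentVectors S p) :=
  hΩ.exists_collar_hypersurface hΓ
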